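/- Let $a<0$, $b>a$, $\sigma,\mu,\lambda>0$, and let $\varphi$ be a continuous, symmetric probability density on $\mathbb R$ with support contained in $(-J,J)$ for some $J>0$. Write $(\cdot,\cdot)$, $\|\cdot\|$ for the scalar product and norm of $L_2(a,b)$, extend functions on $(a,b)$ by zero, and put $\mathcal I v(x)=\lambda\int_{\mathbb R}(v(x+y)-v(x))\varphi(y)\,dy$ and $$A(u,v)=\int_a^b\big(\tfrac12\sigma^2u'v'+\mu x\,u'v\big)\,dx-\int_a^b(\mathcal I u)\,v\,dx .$$ For $f\in L_2(a,b)$ a weak solution of $-\tfrac12\sigma^2v''+\mu xv'-\mathcal I v=f$ in $(a,b)$, $v=0$ outside $(a,b)$, is a $v\in H^1_0(a,b)$ with $A(v,\phi)=(f,\phi)$ for all $\phi\in H^1_0(a,b)$; for $g\in L_2(a,b)$ a weak solution of the adjoint problem is a $w\in H^1_0(a,b)$ with $A(\phi,w)=(\phi,g)$ for all $\phi\in H_0^1(a,b)$. Given a mesh $a=x_0<\dots<x_N=b$, let $V_h\subset H^1_0(a,b)$ be the continuous functions that vanish at $a$ and $b$ and are polynomials of degree $\le 1$ on each $[x_{j-1},x_j]$;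 a finite element solution is a $v_h\in V_h$ with $A(v_h,\phi_h)=(f,\phi_h)$ for all $\phi_h\in V_h$. Call $c$ a regularity constant if, for all $f,g\in L_2(a,b)$, every weak solution $v$ for $f$ and every adjoint weak solution $w$ for $g$ belong to $H^2(a,b)$ and satisfy $\|D^2v\|\le c\|f\|$, $\|D^2w\|\le c\|g\|$. Let $$c_2=\tfrac{b-a}{\pi},\qquad c_1=\tfrac12\sigma^2+c_2\big(\mu\max(|a|,|b|)+2\lambda c_2\big).$$ **Statement.** (i) For every right-hand side in $L_2(a,b)$, the problem and its adjoint each have a unique weak solution. (ii) A regularity constant depending only on $a,b,\sigma,\mu,\lambda$ is $c_7+c_6c_8$, where $\hat\gamma=\frac{\mu b}{\sigma^2}+\sqrt{\frac{2(\lambda+1)}{\sigma^2}+\frac{\mu^2b^2}{\sigma^4}}$, $c_5=(b-a)e^{\hat\gamma(b-a)}$, $c_6=c_2\big(2\sigma^{-2}\mu^{-1}+4\sigma^{-4}\mu^{2}c_5^2\big)^{1/2}$, $c_7=4\sigma^{-2}$, $c_8=4\sigma^{-2}\big(2\lambda+\mu+\sigma^{-2}\mu^2\max(|a|,|b|)^2\big)$.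 (iii) Let $c_3$ be any regularity constant, let $h_0=\sigma/(2^{1/2}\mu^{1/2}c_1c_3)$, and let the mesh be uniform, $x_j-x_{j-1}=h$ for $j=1,\dots,N$, with $h\le h_0$. Then for every $f\in L_2(a,b)$, with weak solution $v$, there is a unique finite element solution $v_h$, the one-sided derivatives $v'(b)$, $v_h'(b)$ (from the left) exist, and $$|v'(b)-v_h'(b)|\le c_{10}\,h^{1/2}\,\|f\|,\qquad c_{10}=2+4c_1c_3\sigma^{-2}.$$ In particular, for $f(x)=-\mu x$, $$|v'(b)-v_h'(b)|\le c_{11}\,h^{1/2},\qquad c_{11}=c_{10}\,\mu\sqrt{\tfrac{b^3-a^3}{3}} .$$ -/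

import Mathlib

open MeasureTheory Set
open scoped ContDiff

noncomputable section

namespace JumpOU

/-! ### The jump density -/

/-- A continuous symmetric probability density on `ℝ` whose support lies in some interval
`(-J, J)`, `J > 0`. -/
structure IsJumpDensity (φ : ℝ → ℝ) : Prop where
  continuous : Continuous φ
  nonneg : ∀ y, 0 ≤ φ y
  symm : ∀ y, φ (-y) = φ y
  integral_eq_one : ∫ y, φ y = 1
  support_bounded : ∃ J : ℝ, 0 < J ∧ tsupport φ ⊆ Ioo (-J) J

/-! ### `L₂(a,b)` and Sobolev spaces on an interval -/

/-- `f ∈ L₂(a,b)`. -/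
def MemL2 (a b : ℝ) (f : ℝ → ℝ) : Prop :=
  MemLp f 2 (volume.restrict (Ioo a b))

/-- The scalar product `(f,g)` of `L₂(a,b)`. -/
def l2inner (a b : ℝ) (f g : ℝ → ℝ) : ℝ := ∫ x in a..b, f x * g x

/-- The norm `‖f‖` of `L₂(a,b)`. -/
def l2norm (a b : ℝ) (f : ℝ → ℝ) : ℝ := Real.sqrt (∫ x in a..b, f x ^ 2)

/-- `g ∈ L₂(a,b)` is a weak derivative of `v` on `(a,b)`. -/
def IsWeakDeriv (a b : ℝ) (v g : ℝ → ℝ) : Prop :=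
  MemL2 a b g ∧
    ∀ ψ : ℝ → ℝ, ContDiff ℝ ∞ ψ → HasCompactSupport ψ → tsupport ψ ⊆ Ioo a b →
      ∫ x in a..b, v x * deriv ψ x = -∫ x in a..b, g x * ψ x

/-- `v ∈ H¹(a,b)`. -/
def MemH1 (a b : ℝ) (v : ℝ → ℝ) : Prop :=
  MemL2 a b v ∧ ∃ g, IsWeakDeriv a b v g

open Classical in
/-- The weak derivative `Dv` of `v ∈ H¹(a,b)` (a representative of it; it is determined up to
equality almost everywhere on `(a,b)`). -/
def weakDeriv (a b : ℝ) (v : ℝ → ℝ) : ℝ → ℝ :=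
  if h : ∃ g, IsWeakDeriv a b v g then h.choose else 0

/-- `v ∈ H²(a,b)`. -/
def MemH2 (a b : ℝ) (v : ℝ → ℝ) : Prop :=
  MemH1 a b v ∧ MemH1 a b (weakDeriv a b v)

/-- `v ∈ H¹₀(a,b)`: `v` is the continuous representative of an element of `H¹(a,b)` with
`v(a) = v(b) = 0`, and it is extended by zero outside `(a,b)`. -/
structure MemH10 (a b : ℝ) (v : ℝ → ℝ) : Prop where
  memH1 : MemH1 a b v
  continuousOn : ContinuousOn v (Icc a b)
  eq_zero : ∀ x, x ∉ Ioo a b → v x = 0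

/-! ### The bilinear form and weak solutions -/

/-- The integral operator `(𝓘 v)(x) = λ ∫ (v(x+y) - v(x)) φ(y) dy`. -/
def jumpOp (lam : ℝ) (φ v : ℝ → ℝ) (x : ℝ) : ℝ :=
  lam * ∫ y, (v (x + y) - v x) * φ y

/-- The bilinear form
`A(u,v) = ∫_a^b (σ²/2 u' v' + μ x u' v) dx - ∫_a^b (𝓘 u) v dx`. -/
def bilin (a b σ μ lam : ℝ) (φ u v : ℝ → ℝ) : ℝ :=
  (∫ x in a..b, (σ ^ 2 / 2 * weakDeriv a b u x * weakDeriv a b v x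
      + μ * x * weakDeriv a b u x * v x))
    - ∫ x in a..b, jumpOp lam φ u x * v x

/-- `v` is the weak solution in `H¹₀(a,b)` of
`-σ²/2 v'' + μ x v' - 𝓘 v = f` in `(a,b)`, `v = 0` outside `(a,b)`. -/
def IsWeakSolution (a b σ μ lam : ℝ) (φ f v : ℝ → ℝ) : Prop :=
  MemH10 a b v ∧ ∀ ψ, MemH10 a b ψ → bilin a b σ μ lam φ v ψ = l2inner a b f ψ

/-- `w` is the weak solution in `H¹₀(a,b)` of the adjoint problem with right-hand side `g`. -/
def IsAdjointWeakSolution (a b σ μ lam : ℝ) (φ g w : ℝ → ℝ) : Prop :=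
  MemH10 a b w ∧ ∀ ψ, MemH10 a b ψ → bilin a b σ μ lam φ ψ w = l2inner a b ψ g

/-- `c` is a constant in the `H²` regularity estimates `‖D²v‖ ≤ c ‖f‖` and `‖D²w‖ ≤ c ‖g‖` for
the boundary value problem and for its adjoint. -/
def IsRegularityConst (a b σ μ lam : ℝ) (φ : ℝ → ℝ) (c : ℝ) : Prop :=
  (∀ f v, MemL2 a b f → IsWeakSolution a b σ μ lam φ f v →
    MemH2 a b v ∧ l2norm a b (weakDeriv a b (weakDeriv a b v)) ≤ c * l2norm a b f) ∧
  (∀ g w, MemL2 a b g → IsAdjointWeakSolution a b σ μ lam φ g w →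
    MemH2 a b w ∧ l2norm a b (weakDeriv a b (weakDeriv a b w)) ≤ c * l2norm a b g)

/-! ### The finite element method -/

/-- A mesh `a = x 0 < x 1 < ⋯ < x N = b` of `[a,b]` (the values `x j` with `j > N` play no
role). -/
structure IsMesh (a b : ℝ) (N : ℕ) (x : ℕ → ℝ) : Prop where
  left : x 0 = a
  right : x N = b
  lt : ∀ j < N, x j < x (j + 1)

/-- `v ∈ V_h`: continuous, vanishing at `a` and `b` (and extended by zero), and a polynomial of
degree at most one on each cell of the mesh. -/
structure MemVh (a b : ℝ) (N : ℕ) (x : ℕ → ℝ) (v : ℝ → ℝ) : Prop where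
  continuousOn : ContinuousOn v (Icc a b)
  eq_zero : ∀ y, y ∉ Ioo a b → v y = 0
  affine : ∀ j < N, ∃ α β : ℝ, ∀ y ∈ Icc (x j) (x (j + 1)), v y = α + β * y

/-- `v` solves the finite element equations: `v ∈ V_h` and `A(v,ψ) = (f,ψ)` for `ψ ∈ V_h`. -/
def IsFEMSolution (a b σ μ lam : ℝ) (φ f : ℝ → ℝ) (N : ℕ) (x : ℕ → ℝ) (v : ℝ → ℝ) : Prop :=
  MemVh a b N x v ∧ ∀ ψ, MemVh a b N x ψ → bilin a b σ μ lam φ v ψ = l2inner a b f ψ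

/-! ### The explicit constants -/

/-- The Poincaré constant. -/
def c2 (a b : ℝ) : ℝ := (b - a) / Real.pi

/-- The continuity constant of the bilinear form. -/
def c1 (a b σ μ lam : ℝ) : ℝ :=
  σ ^ 2 / 2 + c2 a b * (μ * max |a| |b| + 2 * lam * c2 a b)

/-- The positive root of `σ²/2 γ² - μ b γ - λ = 1`. -/
def gammaHat (b σ μ lam : ℝ) : ℝ :=
  μ * b / σ ^ 2 + Real.sqrt (2 * (lam + 1) / σ ^ 2 + (μ * b / σ ^ 2) ^ 2)

/-- The constant of the maximum norm estimate. -/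
def c4 (a b σ μ lam : ℝ) : ℝ := Real.exp (gammaHat b σ μ lam * (b - a))

def c5 (a b σ μ lam : ℝ) : ℝ := (b - a) * c4 a b σ μ lam

/-- The constant of the `L₂` stability estimate. -/
def c6 (a b σ μ lam : ℝ) : ℝ :=
  c2 a b * Real.sqrt (2 / (σ ^ 2 * μ) + 4 * μ ^ 2 / σ ^ 4 * c5 a b σ μ lam ^ 2)

def c7 (σ : ℝ) : ℝ := 4 / σ ^ 2

def c8 (a b σ μ lam : ℝ) : ℝ :=
  4 / σ ^ 2 * (2 * lam + μ + μ ^ 2 / σ ^ 2 * max |a| |b| ^ 2)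

/-- The explicit constant of the `H²` regularity estimates. -/
def c3 (a b σ μ lam : ℝ) : ℝ := c7 σ + c6 a b σ μ lam * c8 a b σ μ lam

/-- The mesh size threshold `h₀ = σ / (√2 √μ c₁ c)` that belongs to a regularity constant `c`. -/
def h0 (a b σ μ lam c : ℝ) : ℝ :=
  σ / (Real.sqrt 2 * Real.sqrt μ * c1 a b σ μ lam * c)

/-- `c₁₀ = 2 + 4 c₁ c σ⁻²`, for a regularity constant `c`. -/
def c10 (a b σ μ lam c : ℝ) : ℝ := 2 + 4 * c1 a b σ μ lam * c / σ ^ 2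

/-- `c₁₁ = c₁₀ μ √((b³ - a³)/3)`, for a regularity constant `c`. -/
def c11 (a b σ μ lam c : ℝ) : ℝ :=
  c10 a b σ μ lam c * μ * Real.sqrt ((b ^ 3 - a ^ 3) / 3)

/-- The derivatives of `v` and `w` at the right end point `b` (from within `[a,b]`) exist and
differ by at most `ε`. -/
def EndDerivClose (a b : ℝ) (v w : ℝ → ℝ) (ε : ℝ) : Prop :=
  ∃ d e : ℝ, HasDerivWithinAt v d (Icc a b) b ∧ HasDerivWithinAt w e (Icc a b) b ∧
    |d - e| ≤ ε

end JumpOU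

end

open MeasureTheory Set
open scoped ContDiff

noncomputable section

namespace JumpOU

variable {a b c d : ℝ} {f g k u v w q r : ℝ → ℝ} {φ : ℝ → ℝ} {σ μ lam : ℝ}

/-! ### Square integrable functions on an interval -/

/-! The form is not coercive. Integration by parts turns the drift into `-μ/2 ‖v‖²`, while the jump
part is nonnegative because averaging against a symmetric probability density is a contraction of
L₂. What remains is a Gårding inequality (`garding`), so solvability rests on the Fredholm
alternative. `H¹₀` is identified with the derivatives of mean zero, on which the form becomes a
compact perturbation of an invertible operator (`isUnit_formOp`). Injectivity is uniqueness of weak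
solutions, and the adjoint problem is governed by the adjoint operator.

Uniqueness comes from a maximum principle. For continuous `f` a weak solution is twice continuously
differentiable inside the interval, and comparison with the barrier `F (exp (γ (b - a)) - exp (γ (x
- a)))` bounds the maximum of `|v|` by `c4` times that of `|f|` (`IsWeakSolution.abs_le`). By
duality this is an L₁ bound for the adjoint problem. Combined with the bound of `|w|` by `‖w'‖` and
with Gårding it becomes L₂ stability with constant `c6`, and a second duality carries that to the
original problem. The equation then expresses the second derivative through lower order terms, which
`‖v'‖² ≤ ‖v''‖ ‖v‖` allows to absorb (`l2norm_second_deriv_le`). This yields `c3`.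

The finite element estimate (`l2norm_weakDeriv_error_le`) is Schatz's argument. For the error `e`,
Aubin–Nitsche duality gives `‖e‖ ≤ c1 c₃ (h/π) ‖e'‖`, where `h/π` is the sharp Poincaré constant of
a cell. For `h ≤ h0` the negative term of Gårding is then at most half of the positive one, and
Galerkin orthogonality gives `‖e'‖ = O(h) ‖f‖`. Finally, the discrete derivative is constant on the
last cell, so the error at `b` splits into the oscillation of `v'` over that cell, which is `O(√h)`
because `v''` is square integrable, and the mean of `e'`, at most `‖e'‖/√h`
(`abs_deriv_sub_le_of_affine`). -/

theorem MemL2.add (hf : MemL2 a b f) (hg : MemL2 a b g) : MemL2 a b (fun x => f x + g x) :=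
  MemLp.add hf hg

theorem MemL2.sub (hf : MemL2 a b f) (hg : MemL2 a b g) : MemL2 a b (fun x => f x - g x) :=
  MemLp.sub hf hg

theorem MemL2.neg (hf : MemL2 a b f) : MemL2 a b (fun x => -f x) :=
  MemLp.neg hf

theorem MemL2.const_mul (hf : MemL2 a b f) (r : ℝ) : MemL2 a b (fun x => r * f x) :=
  MemLp.const_mul hf r

theorem MemL2.congr (hf : MemL2 a b f) (h : f =ᵐ[volume.restrict (Ioo a b)] g) : MemL2 a b g :=
  (memLp_congr_ae h).1 hf

theorem MemL2.mono (hf : MemL2 a b f) (hac : a ≤ c) (hdb : d ≤ b) : MemL2 c d f :=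
  MemLp.mono_measure (Measure.restrict_mono (Ioo_subset_Ioo hac hdb) le_rfl) hf

theorem memL2_of_continuousOn (hf : ContinuousOn f (Icc a b)) : MemL2 a b f := by
  obtain ⟨C, hC⟩ := isCompact_Icc.exists_bound_of_continuousOn hf
  refine MemLp.of_bound ?_ C ?_
  · exact (hf.mono Ioo_subset_Icc_self).aestronglyMeasurable measurableSet_Ioo
  · exact (ae_restrict_iff' measurableSet_Ioo).2
      (Filter.Eventually.of_forall fun x hx => hC x (Ioo_subset_Icc_self hx))

theorem MemL2.continuousOn_mul (hf : MemL2 a b f) (hg : ContinuousOn g (Icc a b)) :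
    MemL2 a b (fun x => g x * f x) := by
  obtain ⟨C, hC⟩ := isCompact_Icc.exists_bound_of_continuousOn hg
  have hm : AEStronglyMeasurable g (volume.restrict (Ioo a b)) :=
    (hg.mono Ioo_subset_Icc_self).aestronglyMeasurable measurableSet_Ioo
  refine MemLp.of_le_mul (c := C) hf (hm.mul hf.1) ?_
  refine (ae_restrict_iff' measurableSet_Ioo).2 (Filter.Eventually.of_forall fun x hx => ?_)
  rw [norm_mul]
  exact mul_le_mul_of_nonneg_right (hC x (Ioo_subset_Icc_self hx)) (norm_nonneg _)

theorem intervalIntegral_eq_Ioo (hab : a ≤ b) (f : ℝ → ℝ) :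
    ∫ x in a..b, f x = ∫ x in Ioo a b, f x := by
  rw [intervalIntegral.integral_of_le hab, integral_Ioc_eq_integral_Ioo]

theorem intervalIntegrable_iff_Ioo (hab : a ≤ b) :
    IntervalIntegrable f volume a b ↔ Integrable f (volume.restrict (Ioo a b)) :=
  intervalIntegrable_iff_integrableOn_Ioo_of_le hab

theorem intervalIntegral_congr_Ioo (hab : a ≤ b) (h : f =ᵐ[volume.restrict (Ioo a b)] g) :
    ∫ x in a..b, f x = ∫ x in a..b, g x := by
  rw [intervalIntegral_eq_Ioo hab, intervalIntegral_eq_Ioo hab]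
  exact integral_congr_ae h

theorem MemL2.mul (hab : a ≤ b) (hf : MemL2 a b f) (hg : MemL2 a b g) :
    IntervalIntegrable (fun x => f x * g x) volume a b := by
  rw [intervalIntegrable_iff_Ioo hab]
  exact MemLp.integrable_mul hf hg

theorem MemL2.sq (hab : a ≤ b) (hf : MemL2 a b f) :
    IntervalIntegrable (fun x => f x ^ 2) volume a b := by
  simpa only [pow_two] using hf.mul hab hf

theorem MemL2.intervalIntegrable (hab : a ≤ b) (hf : MemL2 a b f) :
    IntervalIntegrable f volume a b := by
  rw [intervalIntegrable_iff_Ioo hab]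
  exact MemLp.integrable one_le_two hf

theorem l2norm_nonneg (a b : ℝ) (f : ℝ → ℝ) : 0 ≤ l2norm a b f := Real.sqrt_nonneg _

theorem l2norm_sq (hab : a ≤ b) (f : ℝ → ℝ) : l2norm a b f ^ 2 = ∫ x in a..b, f x ^ 2 :=
  Real.sq_sqrt (intervalIntegral.integral_nonneg hab fun _ _ => sq_nonneg _)

theorem l2norm_congr (hab : a ≤ b) (h : f =ᵐ[volume.restrict (Ioo a b)] g) :
    l2norm a b f = l2norm a b g := by
  unfold l2norm
  rw [intervalIntegral_congr_Ioo hab (g := fun x => g x ^ 2)]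
  filter_upwards [h] with x hx
  rw [hx]

theorem l2inner_eq_inner (hab : a ≤ b) (hf : MemL2 a b f) (hg : MemL2 a b g) :
    l2inner a b f g = inner ℝ (MemLp.toLp f hf) (MemLp.toLp g hg) := by
  rw [MeasureTheory.L2.inner_def, l2inner, intervalIntegral_eq_Ioo hab]
  refine integral_congr_ae ?_
  filter_upwards [hf.coeFn_toLp, hg.coeFn_toLp] with x h1 h2
  rw [h1, h2, real_inner_eq_re_inner]
  simp [mul_comm]

theorem l2norm_eq_norm (hab : a ≤ b) (hf : MemL2 a b f) :
    l2norm a b f = ‖MemLp.toLp f hf‖ := by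
  rw [norm_eq_sqrt_real_inner, ← l2inner_eq_inner hab hf hf]
  simp only [l2norm, l2inner, sq]

/-- The Cauchy–Schwarz inequality. -/
theorem abs_integral_mul_le (hab : a ≤ b) (hf : MemL2 a b f) (hg : MemL2 a b g) :
    |∫ x in a..b, f x * g x| ≤ l2norm a b f * l2norm a b g := by
  have := abs_real_inner_le_norm (MemLp.toLp f hf) (MemLp.toLp g hg)
  rwa [← l2inner_eq_inner hab, ← l2norm_eq_norm hab, ← l2norm_eq_norm hab] at this

theorem integral_mul_le (hab : a ≤ b) (hf : MemL2 a b f) (hg : MemL2 a b g) :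
    ∫ x in a..b, f x * g x ≤ l2norm a b f * l2norm a b g :=
  (le_abs_self _).trans (abs_integral_mul_le hab hf hg)

theorem l2norm_add_le (hab : a ≤ b) (hf : MemL2 a b f) (hg : MemL2 a b g) :
    l2norm a b (fun x => f x + g x) ≤ l2norm a b f + l2norm a b g := by
  rw [l2norm_eq_norm hab hf, l2norm_eq_norm hab hg, l2norm_eq_norm hab (hf.add hg)]
  exact norm_add_le (MemLp.toLp f hf) (MemLp.toLp g hg)

theorem l2norm_const_mul (r : ℝ) (f : ℝ → ℝ) :
    l2norm a b (fun x => r * f x) = |r| * l2norm a b f := by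
  simp only [l2norm, mul_pow, intervalIntegral.integral_const_mul]
  rw [Real.sqrt_mul (sq_nonneg r), Real.sqrt_sq_eq_abs]

theorem l2norm_neg (f : ℝ → ℝ) : l2norm a b (fun x => -f x) = l2norm a b f := by
  simp [l2norm]

theorem l2norm_sub_le (hab : a ≤ b) (hf : MemL2 a b f) (hg : MemL2 a b g) :
    l2norm a b (fun x => f x - g x) ≤ l2norm a b f + l2norm a b g := by
  have := l2norm_add_le hab hf hg.neg
  rwa [l2norm_neg] at this

theorem integral_sq_mono (hab : a ≤ b) (hac : a ≤ c) (hcd : c ≤ d) (hdb : d ≤ b)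
    (hf : MemL2 a b f) : ∫ x in c..d, f x ^ 2 ≤ ∫ x in a..b, f x ^ 2 := by
  refine intervalIntegral.integral_mono_interval hac hcd hdb ?_ (hf.sq hab)
  exact Filter.Eventually.of_forall fun x => sq_nonneg _

theorem l2norm_mono (hab : a ≤ b) (hac : a ≤ c) (hcd : c ≤ d) (hdb : d ≤ b)
    (hf : MemL2 a b f) : l2norm c d f ≤ l2norm a b f :=
  Real.sqrt_le_sqrt (integral_sq_mono hab hac hcd hdb hf)

theorem l2norm_le_of_abs_le (hab : a ≤ b) (hf : MemL2 a b f) (hg : MemL2 a b g)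
    (h : ∀ x ∈ Icc a b, |f x| ≤ |g x|) : l2norm a b f ≤ l2norm a b g := by
  refine Real.sqrt_le_sqrt (intervalIntegral.integral_mono_on hab (hf.sq hab) (hg.sq hab) ?_)
  exact fun x hx => sq_le_sq.2 (h x hx)

theorem l2norm_one : l2norm a b (fun _ => 1) = Real.sqrt (b - a) := by
  simp [l2norm]

theorem abs_integral_le (hab : a ≤ b) (hf : MemL2 a b f) :
    |∫ x in a..b, f x| ≤ Real.sqrt (b - a) * l2norm a b f := by
  have := abs_integral_mul_le hab hf (memL2_of_continuousOn (a := a) (b := b)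
    (continuousOn_const (c := (1 : ℝ))))
  rw [l2norm_one] at this
  simpa [mul_comm] using this

theorem integral_abs_le (hab : a ≤ b) (hf : MemL2 a b f) :
    ∫ x in a..b, |f x| ≤ Real.sqrt (b - a) * l2norm a b f := by
  have := abs_integral_le (f := fun x => |f x|) hab (MemLp.abs hf)
  simp only [l2norm, sq_abs] at this ⊢
  exact (le_abs_self _).trans this

/-! ### Primitives of square integrable functions -/

/-- On `[a,b]` the function `v` is a primitive of the square integrable function `g`. -/
structure IsPrim (a b : ℝ) (v g : ℝ → ℝ) : Prop where
  memL2 : MemL2 a b g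
  eq_add : ∀ x ∈ Icc a b, v x = v a + ∫ t in a..x, g t

theorem IsPrim.sub_eq (h : IsPrim a b v g) {x y : ℝ} (hx : x ∈ Icc a b) (hy : y ∈ Icc a b) :
    v y - v x = ∫ t in x..y, g t := by
  have hab : a ≤ b := hx.1.trans hx.2
  have hi := h.memL2.intervalIntegrable hab
  have h1 : ∀ z ∈ Icc a b, IntervalIntegrable g volume a z := fun z hz =>
    hi.mono_set (by rw [uIcc_of_le hab, uIcc_of_le hz.1]; exact Icc_subset_Icc le_rfl hz.2)
  rw [h.eq_add x hx, h.eq_add y hy, ← intervalIntegral.integral_interval_sub_left (h1 y hy)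
    (h1 x hx)]
  ring

theorem IsPrim.mono (h : IsPrim a b v g) (hac : a ≤ c) (hcd : c ≤ d) (hdb : d ≤ b) :
    IsPrim c d v g := by
  refine ⟨h.memL2.mono hac hdb, fun x hx => ?_⟩
  rw [← h.sub_eq ⟨hac, hcd.trans hdb⟩ ⟨hac.trans hx.1, hx.2.trans hdb⟩]
  ring

/-- Indefinite integrals are absolutely continuous, which gives access to integration by parts for
functions differentiable only almost everywhere. The explicit formula stands in for `v`, whose
values outside `[a,b]` are unconstrained. -/
theorem IsPrim.absolutelyContinuous (hab : a ≤ b) (h : IsPrim a b v g) :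
    AbsolutelyContinuousOnInterval (fun x => v a + ∫ t in a..x, g t) a b := by
  have h1 := (h.memL2.intervalIntegrable hab).absolutelyContinuousOnInterval_intervalIntegral
    (c := a) left_mem_uIcc
  have h2 : AbsolutelyContinuousOnInterval (fun _ : ℝ => v a) a b :=
    contDiffOn_const.absolutelyContinuousOnInterval
  exact h2.fun_add h1

theorem IsPrim.continuousOn (hab : a ≤ b) (h : IsPrim a b v g) : ContinuousOn v (Icc a b) := by
  have := (h.absolutelyContinuous hab).continuousOn
  rw [uIcc_of_le hab] at this
  exact this.congr h.eq_add

theorem IsPrim.memL2_left (hab : a ≤ b) (h : IsPrim a b v g) : MemL2 a b v :=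
  memL2_of_continuousOn (h.continuousOn hab)

theorem IsPrim.add (h1 : IsPrim a b v g) (h2 : IsPrim a b w k) :
    IsPrim a b (fun x => v x + w x) (fun x => g x + k x) := by
  refine ⟨h1.memL2.add h2.memL2, fun x hx => ?_⟩
  have e1 := (h1.memL2.mono le_rfl hx.2).intervalIntegrable hx.1
  have e2 := (h2.memL2.mono le_rfl hx.2).intervalIntegrable hx.1
  simp only [h1.eq_add x hx, h2.eq_add x hx, intervalIntegral.integral_add e1 e2]
  ring

theorem IsPrim.const_mul (h : IsPrim a b v g) (r : ℝ) :
    IsPrim a b (fun x => r * v x) (fun x => r * g x) := by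
  refine ⟨h.memL2.const_mul r, fun x hx => ?_⟩
  simp only [h.eq_add x hx, intervalIntegral.integral_const_mul]
  ring

theorem IsPrim.sub (h1 : IsPrim a b v g) (h2 : IsPrim a b w k) :
    IsPrim a b (fun x => v x - w x) (fun x => g x - k x) := by
  simpa [sub_eq_add_neg] using h1.add (h2.const_mul (-1))

theorem isPrim_const (r : ℝ) : IsPrim a b (fun _ => r) (fun _ => 0) :=
  ⟨memL2_of_continuousOn continuousOn_const, fun x _ => by simp⟩

theorem IsPrim.congr_left (h : IsPrim a b v g) (hab : a ≤ b) (e : ∀ x ∈ Icc a b, w x = v x) :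
    IsPrim a b w g :=
  ⟨h.memL2, fun x hx => by rw [e x hx, e a ⟨le_rfl, hab⟩, h.eq_add x hx]⟩

theorem IsPrim.congr_right (h : IsPrim a b v g) (e : g =ᵐ[volume.restrict (Ioo a b)] k) :
    IsPrim a b v k := by
  refine ⟨h.memL2.congr e, fun x hx => ?_⟩
  rw [h.eq_add x hx, intervalIntegral_congr_Ioo hx.1]
  exact ae_restrict_of_ae_restrict_of_subset (Ioo_subset_Ioo le_rfl hx.2) e

theorem isPrim_of_hasDerivAt (hv : ContinuousOn v (Icc a b))
    (h : ∀ x ∈ Ioo a b, HasDerivAt v (g x) x) (hg : ContinuousOn g (Icc a b)) :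
    IsPrim a b v g := by
  refine ⟨memL2_of_continuousOn hg, fun x hx => ?_⟩
  have hs : Icc a x ⊆ Icc a b := Icc_subset_Icc le_rfl hx.2
  rw [intervalIntegral.integral_eq_sub_of_hasDerivAt_of_le hx.1 (hv.mono hs)
    (fun y hy => h y ⟨hy.1, hy.2.trans_le hx.2⟩)
    ((hg.mono hs).intervalIntegrable_of_Icc hx.1)]
  ring

theorem IsPrim.ae_hasDerivAt (hab : a ≤ b) (h : IsPrim a b v g) :
    ∀ᵐ x, x ∈ Ioo a b → HasDerivAt (fun x => v a + ∫ t in a..x, g t) (g x) x := by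
  filter_upwards [(h.memL2.intervalIntegrable hab).ae_hasDerivAt_integral] with x hx hx'
  have hx'' : x ∈ uIcc a b := by rw [uIcc_of_le hab]; exact Ioo_subset_Icc_self hx'
  exact (hx hx'' a left_mem_uIcc).const_add _

/-- The product rule. -/
theorem IsPrim.mul (hab : a ≤ b) (h1 : IsPrim a b v g) (h2 : IsPrim a b w k) :
    IsPrim a b (fun x => v x * w x) (fun x => g x * w x + v x * k x) := by
  have c1 := h1.continuousOn hab
  have c2 := h2.continuousOn hab
  have m1 : MemL2 a b (fun x => g x * w x) := by
    simpa only [mul_comm] using h1.memL2.continuousOn_mul c2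
  refine ⟨m1.add (h2.memL2.continuousOn_mul c1), fun x hx => ?_⟩
  have h1' := h1.mono le_rfl hx.1 hx.2
  have h2' := h2.mono le_rfl hx.1 hx.2
  have key := (h1'.absolutelyContinuous hx.1).integral_deriv_mul_eq_sub
    (h2'.absolutelyContinuous hx.1)
  rw [← h1'.eq_add x ⟨hx.1, le_rfl⟩, ← h2'.eq_add x ⟨hx.1, le_rfl⟩] at key
  simp only [intervalIntegral.integral_same, add_zero] at key
  rw [intervalIntegral_congr_Ioo hx.1 (g := fun x => g x * w x + v x * k x)] at key
  · rw [key]; ring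
  · refine (ae_restrict_iff' measurableSet_Ioo).2 ?_
    filter_upwards [h1'.ae_hasDerivAt hx.1, h2'.ae_hasDerivAt hx.1] with y d1 d2 hy
    rw [(d1 hy).deriv, (d2 hy).deriv, ← h1'.eq_add y (Ioo_subset_Icc_self hy),
      ← h2'.eq_add y (Ioo_subset_Icc_self hy)]

/-- Integration by parts. -/
theorem IsPrim.integral_mul (hab : a ≤ b) (h1 : IsPrim a b v g) (h2 : IsPrim a b w k) :
    ∫ x in a..b, v x * k x = v b * w b - v a * w a - ∫ x in a..b, g x * w x := by
  have h := (h1.mul hab h2).sub_eq (left_mem_Icc.2 hab) (right_mem_Icc.2 hab)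
  rw [intervalIntegral.integral_add (h1.memL2.mul hab (h2.memL2_left hab))
    ((h1.memL2_left hab).mul hab h2.memL2)] at h
  linarith

/-! ### Weak derivatives -/

theorem isPrim_of_contDiff {ψ : ℝ → ℝ} (h : ContDiff ℝ ∞ ψ) : IsPrim a b ψ (deriv ψ) :=
  isPrim_of_hasDerivAt h.continuous.continuousOn
    (fun x _ => (h.differentiable (by simp) x).hasDerivAt)
    (h.continuous_deriv (by simp)).continuousOn

theorem eq_zero_of_tsupport {ψ : ℝ → ℝ} (h : tsupport ψ ⊆ Ioo a b) {x : ℝ} (hx : x ∉ Ioo a b) :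
    ψ x = 0 :=
  image_eq_zero_of_notMem_tsupport fun h' => hx (h h')

theorem IsPrim.isWeakDeriv (hab : a ≤ b) (h : IsPrim a b v g) : IsWeakDeriv a b v g := by
  refine ⟨h.memL2, fun ψ hψ _ hs => ?_⟩
  rw [h.integral_mul hab (isPrim_of_contDiff hψ), eq_zero_of_tsupport hs (by simp),
    eq_zero_of_tsupport hs (by simp)]
  simp

/-- The fundamental lemma of the calculus of variations. -/
theorem ae_eq_of_integral_test (hab : a ≤ b) (hf : IntervalIntegrable f volume a b)
    (hg : IntervalIntegrable g volume a b)
    (h : ∀ ψ : ℝ → ℝ, ContDiff ℝ ∞ ψ → HasCompactSupport ψ → tsupport ψ ⊆ Ioo a b →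
      ∫ x in a..b, f x * ψ x = ∫ x in a..b, g x * ψ x) :
    f =ᵐ[volume.restrict (Ioo a b)] g := by
  have hi : IntegrableOn (fun x => f x - g x) (Ioo a b) := by
    have := (intervalIntegrable_iff_Ioo hab).1 (hf.sub hg)
    exact this
  have key := isOpen_Ioo.ae_eq_zero_of_integral_contDiff_smul_eq_zero
    (μ := volume) (f := fun x => f x - g x) (U := Ioo a b) hi.locallyIntegrableOn ?_
  · refine (ae_restrict_iff' measurableSet_Ioo).2 ?_
    filter_upwards [key] with x hx hx'
    linarith [hx hx']
  · intro ψ h1 h2 h3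
    have c : ContinuousOn ψ (uIcc a b) := h1.continuous.continuousOn
    have e := h ψ h1 h2 h3
    rw [← sub_eq_zero, ← intervalIntegral.integral_sub (hf.mul_continuousOn c)
      (hg.mul_continuousOn c), intervalIntegral_eq_Ioo hab] at e
    rw [← e, setIntegral_eq_integral_of_forall_compl_eq_zero]
    · simp only [smul_eq_mul]
      congr 1; ext x; ring
    · intro x hx
      rw [eq_zero_of_tsupport h3 hx]; ring

theorem IsWeakDeriv.ae_eq (hab : a ≤ b) (hg : IsWeakDeriv a b v g) (hk : IsWeakDeriv a b v k) :
    g =ᵐ[volume.restrict (Ioo a b)] k := by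
  refine ae_eq_of_integral_test hab (hg.1.intervalIntegrable hab) (hk.1.intervalIntegrable hab) ?_
  intro ψ h1 h2 h3
  have := hg.2 ψ h1 h2 h3
  have := hk.2 ψ h1 h2 h3
  linarith

theorem isWeakDeriv_weakDeriv (h : IsWeakDeriv a b v g) : IsWeakDeriv a b v (weakDeriv a b v) := by
  have h' : ∃ g, IsWeakDeriv a b v g := ⟨g, h⟩
  rw [weakDeriv, dif_pos h']
  exact h'.choose_spec

theorem IsWeakDeriv.weakDeriv_ae_eq (hab : a ≤ b) (h : IsWeakDeriv a b v g) :
    weakDeriv a b v =ᵐ[volume.restrict (Ioo a b)] g :=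
  (isWeakDeriv_weakDeriv h).ae_eq hab h

theorem IsPrim.weakDeriv_ae_eq (hab : a ≤ b) (h : IsPrim a b v g) :
    weakDeriv a b v =ᵐ[volume.restrict (Ioo a b)] g :=
  (h.isWeakDeriv hab).weakDeriv_ae_eq hab

theorem IsPrim.isPrim_weakDeriv (hab : a ≤ b) (h : IsPrim a b v g) :
    IsPrim a b v (weakDeriv a b v) :=
  h.congr_right (h.weakDeriv_ae_eq hab).symm

theorem IsPrim.memH1 (hab : a ≤ b) (h : IsPrim a b v g) : MemH1 a b v :=
  ⟨h.memL2_left hab, g, h.isWeakDeriv hab⟩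

/-- A smooth function with vanishing integral and support in `(a,b)` is the derivative of a test
function. -/
theorem exists_test_primitive {χ : ℝ → ℝ} (hab : a < b) (h1 : ContDiff ℝ ∞ χ)
    (h2 : HasCompactSupport χ)
    (h3 : tsupport χ ⊆ Ioo a b) (h4 : ∫ x in a..b, χ x = 0) :
    ∃ ψ : ℝ → ℝ, ContDiff ℝ ∞ ψ ∧ HasCompactSupport ψ ∧ tsupport ψ ⊆ Ioo a b ∧
      deriv ψ = χ := by
  have hd : ∀ x, HasDerivAt (fun x => ∫ t in a..x, χ t) (χ x) x := fun x =>
    intervalIntegral.integral_hasDerivAt_right (h1.continuous.intervalIntegrable _ _)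
      (h1.continuous.stronglyMeasurableAtFilter _ _) h1.continuous.continuousAt
  have hde : deriv (fun x => ∫ t in a..x, χ t) = χ := funext fun x => (hd x).deriv
  -- The primitive vanishes off a compact interval inside `(a,b)`: to its left because `χ` does, to
  -- its right because the total integral of `χ` is zero.
  obtain ⟨c, d, hac, hdb, hs⟩ : ∃ c d, a < c ∧ d < b ∧ tsupport χ ⊆ Icc c d := by
    rcases (tsupport χ).eq_empty_or_nonempty with he | hne
    · exact ⟨(a + b) / 2, (a + b) / 2, by linarith, by linarith, by simp [he]⟩
    · have hc : IsCompact (tsupport χ) := h2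
      exact ⟨sInf (tsupport χ), sSup (tsupport χ), (h3 (hc.sInf_mem hne)).1,
        (h3 (hc.sSup_mem hne)).2, fun x hx => ⟨csInf_le hc.bddBelow hx, le_csSup hc.bddAbove hx⟩⟩
  have hz : ∀ x, x ∉ Icc c d → χ x = 0 := fun x hx =>
    image_eq_zero_of_notMem_tsupport fun h => hx (hs h)
  have hsupp : Function.support (fun x => ∫ t in a..x, χ t) ⊆ Icc c d := by
    intro x hx
    by_contra hx'
    apply hx
    rw [mem_Icc, not_and_or, not_le, not_le] at hx'
    rcases hx' with hx' | hx'
    · change ∫ t in a..x, χ t = 0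
      rw [intervalIntegral.integral_congr (g := fun _ => (0 : ℝ))]
      · simp
      · intro t ht
        refine hz t fun h => ?_
        rcases le_total a x with h' | h'
        · rw [uIcc_of_le h'] at ht; linarith [h.1, ht.2]
        · rw [uIcc_of_ge h'] at ht; linarith [h.1, ht.2]
    · change ∫ t in a..x, χ t = 0
      rw [← intervalIntegral.integral_add_adjacent_intervals
        (h1.continuous.intervalIntegrable a b) (h1.continuous.intervalIntegrable b x), h4,
        zero_add, intervalIntegral.integral_congr (g := fun _ => (0 : ℝ))]
      · simp
      · intro t ht
        refine hz t fun h => ?_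
        rcases le_total b x with h' | h'
        · rw [uIcc_of_le h'] at ht; linarith [h.2, ht.1]
        · rw [uIcc_of_ge h'] at ht; linarith [h.2, ht.1]
  have hts : tsupport (fun x => ∫ t in a..x, χ t) ⊆ Icc c d :=
    closure_minimal hsupp isClosed_Icc
  refine ⟨fun x => ∫ t in a..x, χ t, ?_, ?_, ?_, hde⟩
  · rw [contDiff_infty_iff_deriv]
    exact ⟨fun x => (hd x).differentiableAt, by rw [hde]; exact h1⟩
  · exact isCompact_Icc.of_isClosed_subset (isClosed_tsupport _) hts
  · exact hts.trans fun x hx => ⟨hac.trans_le hx.1, hx.2.trans_lt hdb⟩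

/-- The lemma of du Bois-Reymond. -/
theorem ae_eq_const_of_integral_deriv_test (hab : a < b) (hu : IntervalIntegrable u volume a b)
    (h : ∀ ψ : ℝ → ℝ, ContDiff ℝ ∞ ψ → HasCompactSupport ψ → tsupport ψ ⊆ Ioo a b →
      ∫ x in a..b, u x * deriv ψ x = 0) :
    ∃ c : ℝ, u =ᵐ[volume.restrict (Ioo a b)] fun _ => c := by
  have hm : (a + b) / 2 ∈ Ioo a b := ⟨by linarith, by linarith⟩
  let η : ContDiffBump ((a + b) / 2) := ⟨(b - a) / 8, (b - a) / 4, by linarith, by linarith⟩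
  have hηs : tsupport η ⊆ Ioo a b := by
    rw [η.tsupport_eq, Real.closedBall_eq_Icc]
    intro x hx
    have h1 : (a + b) / 2 - (b - a) / 4 ≤ x := hx.1
    have h2 : x ≤ (a + b) / 2 + (b - a) / 4 := hx.2
    exact ⟨by linarith, by linarith⟩
  have hηc : ContDiff ℝ ∞ η := η.contDiff
  have hpos : 0 < ∫ x in a..b, η x := by
    have := η.integral_pos (μ := (volume : Measure ℝ))
    rwa [intervalIntegral_eq_Ioo hab.le, setIntegral_eq_integral_of_forall_compl_eq_zero]
    exact fun x hx => eq_zero_of_tsupport hηs hx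
  refine ⟨(∫ x in a..b, u x * η x) / ∫ x in a..b, η x, ?_⟩
  refine ae_eq_of_integral_test hab.le hu intervalIntegrable_const ?_
  intro χ h1 h2 h3
  have hχi := h1.continuous.intervalIntegrable a b (μ := volume)
  have hηi := hηc.continuous.intervalIntegrable a b (μ := volume)
  -- Subtracting `r` times the bump removes the mean of `χ`. The difference is then the derivative
  -- of a test function, and `u` integrates to zero against it.
  set r := (∫ x in a..b, χ x) / ∫ x in a..b, η x with hr
  have hre : r * (∫ x in a..b, η x) = ∫ x in a..b, χ x := div_mul_cancel₀ _ hpos.ne'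
  have hts : tsupport (fun x => χ x - r * η x) ⊆ tsupport χ ∪ tsupport η := by
    refine closure_minimal ?_ ((isClosed_tsupport _).union (isClosed_tsupport _))
    intro x hx
    by_contra hx'
    rw [mem_union, not_or] at hx'
    apply hx
    simp [image_eq_zero_of_notMem_tsupport hx'.1, image_eq_zero_of_notMem_tsupport hx'.2]
  obtain ⟨ψ, p1, p2, p3, p4⟩ := exists_test_primitive (χ := fun x => χ x - r * η x) hab
    (h1.sub (contDiff_const.mul hηc))
    ((IsCompact.union h2 η.hasCompactSupport).of_isClosed_subset (isClosed_tsupport _) hts)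
    (hts.trans (union_subset h3 hηs)) (by
      rw [intervalIntegral.integral_sub hχi (hηi.const_mul r),
        intervalIntegral.integral_const_mul, hre, sub_self])
  have e := h ψ p1 p2 p3
  have i1 := hu.mul_continuousOn (h1.continuous.continuousOn (s := uIcc a b))
  have i2 := hu.mul_continuousOn (hηc.continuous.continuousOn (s := uIcc a b))
  have e2 : ∫ x in a..b, u x * deriv ψ x
      = (∫ x in a..b, u x * χ x) - r * ∫ x in a..b, u x * η x := by
    rw [p4, ← intervalIntegral.integral_const_mul, ← intervalIntegral.integral_sub i1
      (i2.const_mul r)]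
    congr 1; ext x; ring
  rw [intervalIntegral.integral_const_mul]
  rw [e2] at e
  have : r * (∫ x in a..b, u x * η x)
      = (∫ x in a..b, u x * η x) / (∫ x in a..b, η x) * ∫ x in a..b, χ x := by
    rw [hr]; field_simp
  linarith

theorem isPrim_integral (hg : MemL2 a b g) : IsPrim a b (fun x => ∫ t in a..x, g t) g :=
  ⟨hg, fun x _ => by simp⟩

/-- Subtracting the primitive of `g` leaves a function with zero weak derivative, constant almost
everywhere by du Bois-Reymond. -/
theorem IsWeakDeriv.exists_isPrim (hab : a < b) (hv : IntervalIntegrable v volume a b)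
    (h : IsWeakDeriv a b v g) :
    ∃ q, IsPrim a b q g ∧ v =ᵐ[volume.restrict (Ioo a b)] q := by
  have hp := isPrim_integral h.1
  have hpi := (hp.memL2_left hab.le).intervalIntegrable hab.le
  obtain ⟨c, hc⟩ := ae_eq_const_of_integral_deriv_test
    (u := fun x => v x - ∫ t in a..x, g t) hab (hv.sub hpi) (by
      intro ψ h1 h2 h3
      have e1 := h.2 ψ h1 h2 h3
      have e2 := (hp.isWeakDeriv hab.le).2 ψ h1 h2 h3
      have cd : ContinuousOn (deriv ψ) (uIcc a b) :=
        (h1.continuous_deriv (by simp)).continuousOn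
      simp only [sub_mul]
      rw [intervalIntegral.integral_sub (hv.mul_continuousOn cd) (hpi.mul_continuousOn cd), e1, e2,
        sub_self])
  refine ⟨fun x => c + ∫ t in a..x, g t, ?_, ?_⟩
  · simpa using (isPrim_const c).add hp
  · filter_upwards [hc] with x hx
    linarith

/-- Both `v` and its absolutely continuous representative are continuous on `[a,b]`, so equality
almost everywhere becomes equality. From here on the abstract definition of `H¹₀` is replaced by the
fundamental theorem of calculus. -/
theorem MemH10.isPrim (hab : a < b) (h : MemH10 a b v) : IsPrim a b v (weakDeriv a b v) := by
  obtain ⟨g, hg⟩ := h.memH1.2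
  obtain ⟨q, hq, e⟩ := hg.exists_isPrim hab (h.memH1.1.intervalIntegrable hab.le)
  have e' : EqOn v q (Icc a b) := Measure.eqOn_Icc_of_ae_eq volume hab.ne
    (e.filter_mono (ae_mono (Measure.restrict_congr_set Ioo_ae_eq_Icc).ge))
    h.continuousOn (hq.continuousOn hab.le)
  exact (hq.congr_left hab.le e').isPrim_weakDeriv hab.le

theorem IsPrim.memH10 (hab : a ≤ b) (h : IsPrim a b v g) (h0 : ∀ x, x ∉ Ioo a b → v x = 0) :
    MemH10 a b v :=
  ⟨h.memH1 hab, h.continuousOn hab, h0⟩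

theorem MemH10.left (h : MemH10 a b v) : v a = 0 := h.eq_zero a (by simp)

theorem MemH10.right (h : MemH10 a b v) : v b = 0 := h.eq_zero b (by simp)

theorem memH10_of_test {ψ : ℝ → ℝ} (hab : a ≤ b) (h1 : ContDiff ℝ ∞ ψ)
    (h3 : tsupport ψ ⊆ Ioo a b) : MemH10 a b ψ :=
  (isPrim_of_contDiff h1).memH10 hab fun _ hx => eq_zero_of_tsupport h3 hx

/-! ### The Poincaré inequality -/

/-- Jacobi's device: `θ = k tan (k (x - m))` solves the Riccati equation `θ' = k² + θ²`, so `(v' + θ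
v)²` equals `v'² - k² v²` plus the derivative of `θ v²`, whose integral vanishes. Centring at the
midpoint keeps the argument of the tangent inside `(-π/2, π/2)`. -/
theorem integral_sq_le_of_mul_lt_pi (hab : a < b) (h : IsPrim a b v g) (ha : v a = 0)
    (hb : v b = 0) {k : ℝ} (hk : 0 ≤ k) (hk' : k * (b - a) < Real.pi) :
    k ^ 2 * ∫ x in a..b, v x ^ 2 ≤ ∫ x in a..b, g x ^ 2 := by
  set m := (a + b) / 2 with hm
  have hcos : ∀ x ∈ Icc a b, Real.cos (k * (x - m)) ≠ 0 := by
    intro x hx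
    have h1 : k * (x - m) ≤ k * ((b - a) / 2) :=
      mul_le_mul_of_nonneg_left (by rw [hm]; linarith [hx.2]) hk
    have h2 : k * (-((b - a) / 2)) ≤ k * (x - m) :=
      mul_le_mul_of_nonneg_left (by rw [hm]; linarith [hx.1]) hk
    exact (Real.cos_pos_of_mem_Ioo ⟨by linarith, by linarith⟩).ne'
  have hθd : ∀ x ∈ Icc a b, HasDerivAt (fun x => k * Real.tan (k * (x - m)))
      (k ^ 2 * (1 / Real.cos (k * (x - m)) ^ 2)) x := by
    intro x hx
    have e1 : HasDerivAt (fun x => k * (x - m)) k x := by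
      simpa using ((hasDerivAt_id x).sub_const m).const_mul k
    have := ((Real.hasDerivAt_tan (hcos x hx)).comp x e1).const_mul k
    convert! this using 1
    ring
  have hθ : IsPrim a b (fun x => k * Real.tan (k * (x - m)))
      (fun x => k ^ 2 * (1 / Real.cos (k * (x - m)) ^ 2)) := by
    refine isPrim_of_hasDerivAt (fun x hx => (hθd x hx).continuousAt.continuousWithinAt)
      (fun x hx => hθd x (Ioo_subset_Icc_self hx)) ?_
    refine continuousOn_const.mul (continuousOn_const.div (Continuous.continuousOn (by fun_prop)) ?_)
    exact fun x hx => pow_ne_zero 2 (hcos x hx)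
  have hp := (h.mul hab.le h).mul hab.le hθ
  have h0 := hp.sub_eq (left_mem_Icc.2 hab.le) (right_mem_Icc.2 hab.le)
  simp only [ha, hb, zero_mul, sub_zero] at h0
  have hge : 0 ≤ ∫ x in a..b, (g x + k * Real.tan (k * (x - m)) * v x) ^ 2 :=
    intervalIntegral.integral_nonneg hab.le fun _ _ => sq_nonneg _
  have i1 := h.memL2.sq hab.le
  have i2 := (h.memL2_left hab.le).sq hab.le
  have i3 := hp.memL2.intervalIntegrable hab.le
  have e : ∫ x in a..b, (g x + k * Real.tan (k * (x - m)) * v x) ^ 2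
      = ∫ x in a..b, (g x ^ 2 + ((g x * v x + v x * g x) * (k * Real.tan (k * (x - m)))
        + v x * v x * (k ^ 2 * (1 / Real.cos (k * (x - m)) ^ 2))) - k ^ 2 * v x ^ 2) := by
    refine intervalIntegral.integral_congr fun x hx => ?_
    rw [uIcc_of_le hab.le] at hx
    have hc := hcos x hx
    have hs := Real.sin_sq_add_cos_sq (k * (x - m))
    simp only [Real.tan_eq_sin_div_cos]
    field_simp
    linear_combination (v x ^ 2 * k ^ 2) * hs
  rw [e, intervalIntegral.integral_sub (i1.add i3) (i2.const_mul _),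
    intervalIntegral.integral_add i1 i3, ← h0, intervalIntegral.integral_const_mul] at hge
  linarith

/-- The Poincaré inequality with the sharp constant. -/
theorem l2norm_le_c2_mul (hab : a < b) (h : IsPrim a b v g) (ha : v a = 0) (hb : v b = 0) :
    l2norm a b v ≤ c2 a b * l2norm a b g := by
  have hL : 0 < b - a := sub_pos.2 hab
  have hpi := Real.pi_pos
  -- At `k = π/(b - a)` the tangent blows up at the end points, so the sharp constant is reached as
  -- a limit from below.
  have hlim : Filter.Tendsto (fun t : ℝ => (t * (Real.pi / (b - a))) ^ 2 * l2norm a b v ^ 2)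
      (nhdsWithin 1 (Iio 1)) (nhds ((1 * (Real.pi / (b - a))) ^ 2 * l2norm a b v ^ 2)) := by
    refine Filter.Tendsto.mono_left ?_ nhdsWithin_le_nhds
    exact Continuous.tendsto (by fun_prop) 1
  have key : (1 * (Real.pi / (b - a))) ^ 2 * l2norm a b v ^ 2 ≤ l2norm a b g ^ 2 := by
    refine le_of_tendsto hlim ?_
    filter_upwards [Ioo_mem_nhdsLT (zero_lt_one' ℝ)] with t ht
    rw [l2norm_sq hab.le, l2norm_sq hab.le]
    refine integral_sq_le_of_mul_lt_pi hab h ha hb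
      (mul_nonneg ht.1.le (div_nonneg hpi.le hL.le)) ?_
    rw [mul_assoc, div_mul_cancel₀ _ hL.ne']
    nlinarith [ht.2]
  rw [one_mul, ← mul_pow] at key
  have := (pow_le_pow_iff_left₀ (mul_nonneg (div_nonneg hpi.le hL.le) (l2norm_nonneg _ _ _))
    (l2norm_nonneg _ _ _) two_ne_zero).1 key
  rw [c2, div_mul_eq_mul_div, le_div_iff₀ hpi]
  rw [div_mul_eq_mul_div, div_le_iff₀ hL] at this
  linarith

theorem MemH10.l2norm_le (hab : a < b) (h : MemH10 a b v) :
    l2norm a b v ≤ c2 a b * l2norm a b (weakDeriv a b v) :=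
  l2norm_le_c2_mul hab (h.isPrim hab) h.left h.right

/-! ### The jump operator -/

/-- Since `v` vanishes at both end points, its zero extension is `v` composed with the projection of
`ℝ` onto `[a,b]`. -/
theorem MemH10.continuous (hab : a ≤ b) (h : MemH10 a b v) : Continuous v := by
  have e : v = fun x => v (projIcc a b hab x) := by
    ext x
    by_cases hx : x ∈ Ioo a b
    · rw [projIcc_of_mem hab (Ioo_subset_Icc_self hx)]
    · rw [h.eq_zero x hx]
      rcases le_or_gt x a with h1 | h1
      · rw [projIcc_of_le_left hab h1, h.left]
      · have : b ≤ x := not_lt.1 fun h2 => hx ⟨h1, h2⟩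
        rw [projIcc_of_right_le hab this, h.right]
  rw [e]
  exact h.continuousOn.comp_continuous (continuous_subtype_val.comp continuous_projIcc)
    fun x => (projIcc a b hab x).2

theorem MemH10.hasCompactSupport (h : MemH10 a b v) : HasCompactSupport v :=
  HasCompactSupport.intro isCompact_Icc fun x hx =>
    h.eq_zero x fun hx' => hx (Ioo_subset_Icc_self hx')

theorem MemH10.integral_mul (hab : a ≤ b) (h : MemH10 a b v) (f : ℝ → ℝ) :
    ∫ x in a..b, f x * v x = ∫ x, f x * v x := by
  rw [intervalIntegral_eq_Ioo hab, setIntegral_eq_integral_of_forall_compl_eq_zero]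
  exact fun x hx => by rw [h.eq_zero x hx, mul_zero]

theorem MemH10.l2norm_sq (hab : a ≤ b) (h : MemH10 a b v) :
    l2norm a b v ^ 2 = ∫ x, v x ^ 2 := by
  rw [JumpOU.l2norm_sq hab]
  simpa only [pow_two] using h.integral_mul hab v

theorem IsJumpDensity.hasCompactSupport (hφ : IsJumpDensity φ) : HasCompactSupport φ := by
  obtain ⟨J, -, hJ⟩ := hφ.support_bounded
  exact HasCompactSupport.intro isCompact_Icc fun x hx =>
    image_eq_zero_of_notMem_tsupport fun hx' => hx (Ioo_subset_Icc_self (hJ hx'))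

/-- The mean value of `u` around `x` with respect to the jump density. -/
def jumpMean (φ u : ℝ → ℝ) (x : ℝ) : ℝ := ∫ y, u (x + y) * φ y

theorem integrable_jumpMean (hφ : IsJumpDensity φ) (hu : Continuous u) (x : ℝ) :
    Integrable (fun y => u (x + y) * φ y) :=
  ((hu.comp (continuous_const.add continuous_id)).mul
    hφ.continuous).integrable_of_hasCompactSupport hφ.hasCompactSupport.mul_left

theorem jumpOp_eq (hφ : IsJumpDensity φ) (hu : Continuous u) (x : ℝ) :
    jumpOp lam φ u x = lam * (jumpMean φ u x - u x) := by
  have h2 : Integrable (fun y => u x * φ y) :=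
    (hφ.continuous.integrable_of_hasCompactSupport hφ.hasCompactSupport).const_mul _
  simp only [jumpOp, jumpMean, sub_mul]
  rw [integral_sub (integrable_jumpMean hφ hu x) h2, integral_const_mul, hφ.integral_eq_one,
    mul_one]

theorem continuous_jumpMean (hφ : IsJumpDensity φ) (hu : Continuous u) :
    Continuous (jumpMean φ u) := by
  have e : jumpMean φ u = fun x => ∫ y in tsupport φ, u (x + y) * φ y := by
    ext x
    refine (setIntegral_eq_integral_of_forall_compl_eq_zero fun y hy => ?_).symm
    rw [image_eq_zero_of_notMem_tsupport hy, mul_zero]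
  rw [e]
  refine continuous_parametric_integral_of_continuous ?_ hφ.hasCompactSupport
  have := hφ.continuous
  fun_prop

theorem hasCompactSupport_jumpMean (hφ : IsJumpDensity φ) (hu : HasCompactSupport u) :
    HasCompactSupport (jumpMean φ u) := by
  have hK : IsCompact ((fun p : ℝ × ℝ => p.1 - p.2) '' (tsupport u ×ˢ tsupport φ)) :=
    (IsCompact.prod hu hφ.hasCompactSupport).image (by fun_prop)
  refine HasCompactSupport.intro hK fun x hx => ?_
  rw [jumpMean, integral_congr_ae (g := fun _ => (0 : ℝ)), integral_zero]
  refine Filter.Eventually.of_forall fun y => ?_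
  by_cases hy : y ∈ tsupport φ
  · by_cases hxy : x + y ∈ tsupport u
    · exact absurd ⟨(x + y, y), ⟨hxy, hy⟩, by simp⟩ hx
    · simp [image_eq_zero_of_notMem_tsupport hxy]
  · simp [image_eq_zero_of_notMem_tsupport hy]

/-- Fubini writes the pairing as an average over the jump sizes of shifted products. Symmetry and
boundedness are both read off from this form. -/
theorem integral_jumpMean_mul (hφ : IsJumpDensity φ) (hu : Continuous u) (hw : Continuous w)
    (hwc : HasCompactSupport w) :
    ∫ x, jumpMean φ u x * w x = ∫ y, φ y * ∫ x, u (x + y) * w x := by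
  have hφc := hφ.continuous
  have hs : HasCompactSupport (Function.uncurry fun x y => u (x + y) * φ y * w x) := by
    refine HasCompactSupport.intro (IsCompact.prod hwc hφ.hasCompactSupport) fun p hp => ?_
    rw [mem_prod, not_and_or] at hp
    rcases hp with hp | hp
    · simp [Function.uncurry, image_eq_zero_of_notMem_tsupport hp]
    · simp [Function.uncurry, image_eq_zero_of_notMem_tsupport hp]
  have := integral_integral_swap_of_hasCompactSupport (μ := (volume : Measure ℝ))
    (ν := (volume : Measure ℝ)) (f := fun x y => u (x + y) * φ y * w x) (by fun_prop) hs
  simp only [jumpMean, ← integral_mul_const, ← integral_const_mul]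
  rw [this]
  congr 1; ext y; congr 1; ext x; ring

/-- Reflect `y`, use that the density is even, and translate `x` by `y`. -/
theorem integral_jumpMean_mul_comm (hφ : IsJumpDensity φ) (hu : Continuous u)
    (huc : HasCompactSupport u) (hw : Continuous w) (hwc : HasCompactSupport w) :
    ∫ x, jumpMean φ u x * w x = ∫ x, jumpMean φ w x * u x := by
  rw [integral_jumpMean_mul hφ hu hw hwc, integral_jumpMean_mul hφ hw hu huc,
    ← integral_neg_eq_self]
  congr 1; ext y
  rw [hφ.symm, ← integral_add_right_eq_self (fun x => u (x + -y) * w x) y]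
  congr 2; ext x
  rw [add_neg_cancel_right, mul_comm]

/-- For each fixed shift this is Young's inequality with translation invariance; the density has
total mass one. -/
theorem integral_jumpMean_mul_le (hφ : IsJumpDensity φ) (hu : Continuous u)
    (huc : HasCompactSupport u) (hw : Continuous w) (hwc : HasCompactSupport w) :
    ∫ x, jumpMean φ u x * w x ≤ ((∫ x, u x ^ 2) + ∫ x, w x ^ 2) / 2 := by
  have iu : Integrable fun x => u x ^ 2 := by
    simp only [pow_two]
    exact (hu.mul hu).integrable_of_hasCompactSupport huc.mul_right
  have iw : Integrable fun x => w x ^ 2 := by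
    simp only [pow_two]
    exact (hw.mul hw).integrable_of_hasCompactSupport hwc.mul_right
  have hb : ∀ y, ∫ x, u (x + y) * w x ≤ ((∫ x, u x ^ 2) + ∫ x, w x ^ 2) / 2 := by
    intro y
    have iuy : Integrable fun x => u (x + y) ^ 2 := iu.comp_add_right y
    rw [← integral_add_right_eq_self (fun x => u x ^ 2) y, ← integral_add iuy iw,
      ← integral_div]
    refine integral_mono ?_ ((iuy.add iw).div_const 2) fun x => ?_
    · exact ((hu.comp (continuous_id.add continuous_const)).mul
        hw).integrable_of_hasCompactSupport hwc.mul_left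
    · change u (x + y) * w x ≤ (u (x + y) ^ 2 + w x ^ 2) / 2
      nlinarith [sq_nonneg (u (x + y) - w x)]
  have iφ := hφ.continuous.integrable_of_hasCompactSupport (μ := volume) hφ.hasCompactSupport
  rw [integral_jumpMean_mul hφ hu hw hwc]
  calc ∫ y, φ y * ∫ x, u (x + y) * w x
      ≤ ∫ y, φ y * (((∫ x, u x ^ 2) + ∫ x, w x ^ 2) / 2) := by
        refine integral_mono ?_ (iφ.mul_const _) fun y =>
          mul_le_mul_of_nonneg_left (hb y) (hφ.nonneg y)
        refine Continuous.integrable_of_hasCompactSupport (hφ.continuous.mul ?_)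
          hφ.hasCompactSupport.mul_right
        have e : (fun y => ∫ x, u (x + y) * w x)
            = fun y => ∫ x in tsupport w, u (x + y) * w x := by
          ext y
          refine (setIntegral_eq_integral_of_forall_compl_eq_zero fun x hx => ?_).symm
          rw [image_eq_zero_of_notMem_tsupport hx, mul_zero]
        rw [e]
        exact continuous_parametric_integral_of_continuous (by fun_prop) hwc
    _ = ((∫ x, u x ^ 2) + ∫ x, w x ^ 2) / 2 := by
        rw [integral_mul_const, hφ.integral_eq_one, one_mul]

/-- Pair the mean with itself in the preceding bound and absorb the half that reappears on the
right. -/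
theorem integral_jumpMean_sq_le (hφ : IsJumpDensity φ) (hu : Continuous u)
    (huc : HasCompactSupport u) : ∫ x, jumpMean φ u x ^ 2 ≤ ∫ x, u x ^ 2 := by
  have := integral_jumpMean_mul_le hφ hu huc (continuous_jumpMean hφ hu)
    (hasCompactSupport_jumpMean hφ huc)
  simp only [← pow_two] at this
  linarith

theorem continuous_jumpOp (hφ : IsJumpDensity φ) (hu : Continuous u) :
    Continuous (jumpOp lam φ u) := by
  rw [funext (jumpOp_eq hφ hu)]
  exact continuous_const.mul ((continuous_jumpMean hφ hu).sub hu)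

theorem MemH10.memL2_jumpOp (hab : a ≤ b) (hφ : IsJumpDensity φ) (hu : MemH10 a b u) :
    MemL2 a b (jumpOp lam φ u) :=
  memL2_of_continuousOn (continuous_jumpOp hφ (hu.continuous hab)).continuousOn

theorem MemH10.l2norm_jumpMean_le (hab : a ≤ b) (hφ : IsJumpDensity φ) (hu : MemH10 a b u) :
    l2norm a b (jumpMean φ u) ≤ l2norm a b u := by
  have huc := hu.continuous hab
  have hmc := continuous_jumpMean hφ huc
  have hms := hasCompactSupport_jumpMean hφ hu.hasCompactSupport
  refine (pow_le_pow_iff_left₀ (l2norm_nonneg _ _ _) (l2norm_nonneg _ _ _) two_ne_zero).1 ?_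
  rw [hu.l2norm_sq hab, JumpOU.l2norm_sq hab, intervalIntegral_eq_Ioo hab]
  refine (setIntegral_le_integral ?_ (Filter.Eventually.of_forall fun x => sq_nonneg _)).trans
    (integral_jumpMean_sq_le hφ huc hu.hasCompactSupport)
  simp only [pow_two]
  exact (hmc.mul hmc).integrable_of_hasCompactSupport hms.mul_right

theorem MemH10.l2norm_jumpOp_le (hab : a ≤ b) (hφ : IsJumpDensity φ) (hlam : 0 ≤ lam)
    (hu : MemH10 a b u) : l2norm a b (jumpOp lam φ u) ≤ 2 * lam * l2norm a b u := by
  have huc := hu.continuous hab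
  rw [funext (jumpOp_eq hφ huc), l2norm_const_mul, abs_of_nonneg hlam]
  have h1 := l2norm_sub_le hab (memL2_of_continuousOn (a := a) (b := b)
    (continuous_jumpMean hφ huc).continuousOn) (memL2_of_continuousOn huc.continuousOn)
  have h2 := hu.l2norm_jumpMean_le hab hφ
  calc _ ≤ lam * (l2norm a b u + l2norm a b u) := by gcongr; linarith
    _ = _ := by ring

theorem MemH10.integral_jumpOp_mul_comm (hab : a ≤ b) (hφ : IsJumpDensity φ) (hu : MemH10 a b u)
    (hw : MemH10 a b w) :
    ∫ x in a..b, jumpOp lam φ u x * w x = ∫ x in a..b, jumpOp lam φ w x * u x := by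
  have huc := hu.continuous hab
  have hwc := hw.continuous hab
  rw [hw.integral_mul hab, hu.integral_mul hab]
  simp only [jumpOp_eq hφ huc, jumpOp_eq hφ hwc, mul_assoc, sub_mul, integral_const_mul]
  have iuw : Integrable fun x => u x * w x :=
    (huc.mul hwc).integrable_of_hasCompactSupport hw.hasCompactSupport.mul_left
  have iwu : Integrable fun x => w x * u x := by simpa only [mul_comm] using iuw
  have i1 : Integrable fun x => jumpMean φ u x * w x :=
    ((continuous_jumpMean hφ huc).mul hwc).integrable_of_hasCompactSupport
      hw.hasCompactSupport.mul_left
  have i2 : Integrable fun x => jumpMean φ w x * u x :=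
    ((continuous_jumpMean hφ hwc).mul huc).integrable_of_hasCompactSupport
      hu.hasCompactSupport.mul_left
  rw [integral_sub i1 iuw, integral_sub i2 iwu,
    integral_jumpMean_mul_comm hφ huc hu.hasCompactSupport hwc hw.hasCompactSupport]
  simp only [mul_comm (u _)]

/-- Averaging cannot increase the quadratic form, so the jump term has a favourable sign and costs
nothing in the Gårding inequality. -/
theorem MemH10.integral_jumpOp_mul_self_nonpos (hab : a ≤ b) (hφ : IsJumpDensity φ)
    (hlam : 0 ≤ lam) (hu : MemH10 a b u) : ∫ x in a..b, jumpOp lam φ u x * u x ≤ 0 := by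
  have huc := hu.continuous hab
  rw [hu.integral_mul hab]
  simp only [jumpOp_eq hφ huc, mul_assoc, sub_mul, integral_const_mul]
  have iu : Integrable fun x => u x * u x :=
    (huc.mul huc).integrable_of_hasCompactSupport hu.hasCompactSupport.mul_left
  have i1 : Integrable fun x => jumpMean φ u x * u x :=
    ((continuous_jumpMean hφ huc).mul huc).integrable_of_hasCompactSupport
      hu.hasCompactSupport.mul_left
  rw [integral_sub i1 iu]
  have := integral_jumpMean_mul_le hφ huc hu.hasCompactSupport huc hu.hasCompactSupport
  simp only [pow_two] at this
  exact mul_nonpos_of_nonneg_of_nonpos hlam (by linarith)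

/-! ### Linearity of `H¹₀` and of the jump operator -/

theorem MemH10.add (hab : a < b) (hu : MemH10 a b u) (hw : MemH10 a b w) :
    MemH10 a b (fun x => u x + w x) :=
  ((hu.isPrim hab).add (hw.isPrim hab)).memH10 hab.le fun x hx => by
    rw [hu.eq_zero x hx, hw.eq_zero x hx, add_zero]

theorem MemH10.const_mul (hab : a < b) (hu : MemH10 a b u) (r : ℝ) :
    MemH10 a b (fun x => r * u x) :=
  ((hu.isPrim hab).const_mul r).memH10 hab.le fun x hx => by rw [hu.eq_zero x hx, mul_zero]

theorem MemH10.sub (hab : a < b) (hu : MemH10 a b u) (hw : MemH10 a b w) :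
    MemH10 a b (fun x => u x - w x) := by
  simpa [sub_eq_add_neg] using hu.add hab (hw.const_mul hab (-1))

theorem memH10_zero (hab : a ≤ b) : MemH10 a b (fun _ => 0) :=
  (isPrim_const 0).memH10 hab fun _ _ => rfl

theorem jumpOp_add (hφ : IsJumpDensity φ) (hu : Continuous u) (hw : Continuous w) (x : ℝ) :
    jumpOp lam φ (fun x => u x + w x) x = jumpOp lam φ u x + jumpOp lam φ w x := by
  rw [jumpOp_eq hφ hu, jumpOp_eq hφ hw, jumpOp_eq hφ (u := fun x => u x + w x) (hu.add hw)]
  simp only [jumpMean, add_mul]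
  rw [integral_add (integrable_jumpMean hφ hu x) (integrable_jumpMean hφ hw x)]
  ring

theorem jumpOp_const_mul (r : ℝ) (u : ℝ → ℝ) (x : ℝ) :
    jumpOp lam φ (fun x => r * u x) x = r * jumpOp lam φ u x := by
  simp only [jumpOp, ← mul_sub, mul_assoc, integral_const_mul]
  ring

/-! ### The bilinear form -/

theorem MemL2.id_mul (hf : MemL2 a b f) : MemL2 a b (fun x => x * f x) :=
  hf.continuousOn_mul continuousOn_id

theorem l2norm_id_mul_le (hab : a ≤ b) (hf : MemL2 a b f) :
    l2norm a b (fun x => x * f x) ≤ max |a| |b| * l2norm a b f := by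
  have hM : 0 ≤ max |a| |b| := (abs_nonneg a).trans (le_max_left _ _)
  have := l2norm_le_of_abs_le hab hf.id_mul (hf.const_mul (max |a| |b|)) fun x hx => by
    rw [abs_mul, abs_mul, abs_of_nonneg hM]
    exact mul_le_mul_of_nonneg_right (abs_le_max_abs_abs hx.1 hx.2) (abs_nonneg _)
  rwa [l2norm_const_mul, abs_of_nonneg hM] at this

/-- Frees the form from the chosen representative `weakDeriv`: any derivative at hand may be
inserted. -/
theorem bilin_eq (hab : a ≤ b) (hug : IsPrim a b u g)
    (hvk : IsPrim a b v k) :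
    bilin a b σ μ lam φ u v = σ ^ 2 / 2 * (∫ x in a..b, g x * k x)
      + μ * (∫ x in a..b, x * g x * v x) - ∫ x in a..b, jumpOp lam φ u x * v x := by
  rw [bilin, ← intervalIntegral.integral_const_mul, ← intervalIntegral.integral_const_mul,
    ← intervalIntegral.integral_add ((hug.memL2.mul hab hvk.memL2).const_mul _)
      ((hug.memL2.id_mul.mul hab (hvk.memL2_left hab)).const_mul _)]
  congr 1
  refine intervalIntegral_congr_Ioo hab ?_
  filter_upwards [hug.weakDeriv_ae_eq hab, hvk.weakDeriv_ae_eq hab] with x h1 h2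
  rw [h1, h2]
  ring

theorem bilin_add_left (hab : a < b) (hφ : IsJumpDensity φ) (hu : MemH10 a b u)
    (hw : MemH10 a b w) (hv : MemH10 a b v) :
    bilin a b σ μ lam φ (fun x => u x + w x) v
      = bilin a b σ μ lam φ u v + bilin a b σ μ lam φ w v := by
  have pu := hu.isPrim hab
  have pw := hw.isPrim hab
  have pv := hv.isPrim hab
  have mv := pv.memL2_left hab.le
  rw [bilin_eq hab.le (pu.add pw) pv, bilin_eq hab.le pu pv,
    bilin_eq hab.le pw pv]
  simp only [jumpOp_add hφ (hu.continuous hab.le) (hw.continuous hab.le), add_mul, mul_add]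
  rw [intervalIntegral.integral_add (pu.memL2.mul hab.le pv.memL2) (pw.memL2.mul hab.le pv.memL2),
    intervalIntegral.integral_add (pu.memL2.id_mul.mul hab.le mv) (pw.memL2.id_mul.mul hab.le mv),
    intervalIntegral.integral_add ((hu.memL2_jumpOp hab.le hφ).mul hab.le mv)
      ((hw.memL2_jumpOp hab.le hφ).mul hab.le mv)]
  ring

theorem bilin_const_mul_left (hab : a < b) (hu : MemH10 a b u)
    (hv : MemH10 a b v) (s : ℝ) :
    bilin a b σ μ lam φ (fun x => s * u x) v = s * bilin a b σ μ lam φ u v := by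
  have pu := hu.isPrim hab
  have pv := hv.isPrim hab
  rw [bilin_eq hab.le (pu.const_mul s) pv, bilin_eq hab.le pu pv]
  have e : ∀ x, x * (s * weakDeriv a b u x) * v x = s * (x * weakDeriv a b u x * v x) :=
    fun x => by ring
  simp only [jumpOp_const_mul, e, mul_assoc s, intervalIntegral.integral_const_mul]
  ring

theorem bilin_add_right (hab : a < b) (hφ : IsJumpDensity φ) (hu : MemH10 a b u)
    (hw : MemH10 a b w) (hv : MemH10 a b v) :
    bilin a b σ μ lam φ u (fun x => v x + w x)
      = bilin a b σ μ lam φ u v + bilin a b σ μ lam φ u w := by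
  have pu := hu.isPrim hab
  have pw := hw.isPrim hab
  have pv := hv.isPrim hab
  have mv := pv.memL2_left hab.le
  have mw := pw.memL2_left hab.le
  have mj := hu.memL2_jumpOp (lam := lam) hab.le hφ
  rw [bilin_eq hab.le pu (pv.add pw), bilin_eq hab.le pu pv,
    bilin_eq hab.le pu pw]
  simp only [mul_add]
  rw [intervalIntegral.integral_add (pu.memL2.mul hab.le pv.memL2) (pu.memL2.mul hab.le pw.memL2),
    intervalIntegral.integral_add (pu.memL2.id_mul.mul hab.le mv) (pu.memL2.id_mul.mul hab.le mw),
    intervalIntegral.integral_add (mj.mul hab.le mv) (mj.mul hab.le mw)]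
  ring

theorem bilin_const_mul_right (hab : a < b) (hu : MemH10 a b u)
    (hv : MemH10 a b v) (s : ℝ) :
    bilin a b σ μ lam φ u (fun x => s * v x) = s * bilin a b σ μ lam φ u v := by
  have pu := hu.isPrim hab
  have pv := hv.isPrim hab
  rw [bilin_eq hab.le pu (pv.const_mul s), bilin_eq hab.le pu pv]
  simp only [mul_left_comm _ s, intervalIntegral.integral_const_mul]
  ring

theorem bilin_sub_left (hab : a < b) (hφ : IsJumpDensity φ) (hu : MemH10 a b u)
    (hw : MemH10 a b w) (hv : MemH10 a b v) :
    bilin a b σ μ lam φ (fun x => u x - w x) v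
      = bilin a b σ μ lam φ u v - bilin a b σ μ lam φ w v := by
  have := bilin_add_left (σ := σ) (μ := μ) (lam := lam) hab hφ hu (hw.const_mul hab (-1)) hv
  rw [bilin_const_mul_left hab hw hv] at this
  simpa [sub_eq_add_neg] using this

theorem bilin_sub_right (hab : a < b) (hφ : IsJumpDensity φ) (hu : MemH10 a b u)
    (hw : MemH10 a b w) (hv : MemH10 a b v) :
    bilin a b σ μ lam φ u (fun x => v x - w x)
      = bilin a b σ μ lam φ u v - bilin a b σ μ lam φ u w := by
  have := bilin_add_right (σ := σ) (μ := μ) (lam := lam) hab hφ hu (hw.const_mul hab (-1)) hv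
  rw [bilin_const_mul_right hab hu hw] at this
  simpa [sub_eq_add_neg] using this

theorem c2_pos (hab : a < b) : 0 < c2 a b := div_pos (sub_pos.2 hab) Real.pi_pos

theorem c1_pos (hab : a < b) (hσ : 0 < σ) (hμ : 0 < μ) (hlam : 0 < lam) :
    0 < c1 a b σ μ lam := by
  have := c2_pos hab
  have hM : 0 ≤ max |a| |b| := (abs_nonneg a).trans (le_max_left _ _)
  rw [c1]; positivity

/-- Continuity of the bilinear form. -/
theorem abs_bilin_le (hab : a < b) (hφ : IsJumpDensity φ) (hμ : 0 ≤ μ) (hlam : 0 ≤ lam)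
    (hu : MemH10 a b u) (hv : MemH10 a b v) :
    |bilin a b σ μ lam φ u v|
      ≤ c1 a b σ μ lam * l2norm a b (weakDeriv a b u) * l2norm a b (weakDeriv a b v) := by
  have pu := hu.isPrim hab
  have pv := hv.isPrim hab
  have mv := pv.memL2_left hab.le
  have h1 := abs_integral_mul_le hab.le pu.memL2 pv.memL2
  have h2 := abs_integral_mul_le hab.le pu.memL2.id_mul mv
  have h3 := abs_integral_mul_le hab.le (hu.memL2_jumpOp (lam := lam) hab.le hφ) mv
  have h4 := l2norm_id_mul_le hab.le pu.memL2
  have h5 := hu.l2norm_jumpOp_le hab.le hφ hlam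
  have hM : 0 ≤ max |a| |b| := (abs_nonneg a).trans (le_max_left _ _)
  have hc := c2_pos hab
  have pu' := hu.l2norm_le hab
  have pv' := hv.l2norm_le hab
  have n1 := l2norm_nonneg a b (weakDeriv a b u)
  have n2 := l2norm_nonneg a b (weakDeriv a b v)
  have n3 := l2norm_nonneg a b v
  have n4 := l2norm_nonneg a b u
  rw [bilin_eq hab.le pu pv]
  set U := l2norm a b (weakDeriv a b u)
  set V := l2norm a b (weakDeriv a b v)
  calc _ ≤ σ ^ 2 / 2 * (U * V) + μ * ((max |a| |b| * U) * (c2 a b * V))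
          + 2 * lam * (c2 a b * U) * (c2 a b * V) := by
        refine (abs_sub _ _).trans (add_le_add ((abs_add_le _ _).trans (add_le_add ?_ ?_)) ?_)
        · rw [abs_mul, abs_of_nonneg (by positivity)]
          exact mul_le_mul_of_nonneg_left h1 (by positivity)
        · rw [abs_mul, abs_of_nonneg hμ]
          refine mul_le_mul_of_nonneg_left (h2.trans ?_) hμ
          exact mul_le_mul h4 pv' n3 (by positivity)
        · refine h3.trans (mul_le_mul (h5.trans ?_) pv' n3 (by positivity))
          exact mul_le_mul_of_nonneg_left pu' (by positivity)
    _ = _ := by rw [c1]; ring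

/-- Integrate `(x v²)' = v² + 2 x v v'`. The negative sign is what destroys coercivity. -/
theorem integral_id_mul_deriv_mul_self (hab : a ≤ b) (h : IsPrim a b v g) (ha : v a = 0)
    (hb : v b = 0) : ∫ x in a..b, x * g x * v x = -(∫ x in a..b, v x ^ 2) / 2 := by
  have hid : IsPrim a b (fun x => x) (fun _ => 1) :=
    isPrim_of_hasDerivAt continuousOn_id (fun x _ => hasDerivAt_id x) continuousOn_const
  have hp := (hid.mul hab (h.mul hab h)).sub_eq (left_mem_Icc.2 hab) (right_mem_Icc.2 hab)
  have mv := h.memL2_left hab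
  rw [ha, hb, intervalIntegral.integral_congr (g := fun x => v x ^ 2 + 2 * (x * g x * v x))
    (fun x _ => by ring), intervalIntegral.integral_add (mv.sq hab)
    ((h.memL2.id_mul.mul hab mv).const_mul 2), intervalIntegral.integral_const_mul] at hp
  linarith

/-- The Gårding inequality. -/
theorem garding (hab : a < b) (hφ : IsJumpDensity φ) (hlam : 0 ≤ lam) (hu : MemH10 a b u) :
    σ ^ 2 / 2 * l2norm a b (weakDeriv a b u) ^ 2 - μ / 2 * l2norm a b u ^ 2
      ≤ bilin a b σ μ lam φ u u := by
  have pu := hu.isPrim hab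
  have h1 := hu.integral_jumpOp_mul_self_nonpos hab.le hφ hlam
  rw [bilin_eq hab.le pu pu, integral_id_mul_deriv_mul_self hab.le pu hu.left hu.right,
    l2norm_sq hab.le, l2norm_sq hab.le]
  simp only [← pow_two]
  linarith

/-! ### Regularity of weak solutions -/

theorem IsWeakDeriv.congr_left (hab : a ≤ b) (h : IsWeakDeriv a b v g)
    (e : v =ᵐ[volume.restrict (Ioo a b)] w) : IsWeakDeriv a b w g := by
  refine ⟨h.1, fun ψ h1 h2 h3 => ?_⟩
  rw [← h.2 ψ h1 h2 h3]
  refine intervalIntegral_congr_Ioo hab ?_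
  filter_upwards [e] with x hx
  rw [hx]

theorem IsPrim.memH2 (hab : a ≤ b) (h1 : IsPrim a b v q) (h2 : IsPrim a b q r) :
    MemH2 a b v ∧ l2norm a b (weakDeriv a b (weakDeriv a b v)) = l2norm a b r := by
  have e := h1.weakDeriv_ae_eq hab
  have hw := (h2.isWeakDeriv hab).congr_left hab e.symm
  exact ⟨⟨h1.memH1 hab, (isWeakDeriv_weakDeriv (h1.isWeakDeriv hab)).1, r, hw⟩,
    l2norm_congr hab (hw.weakDeriv_ae_eq hab)⟩

/-- Testing with smooth functions shows that `v'` itself has a weak derivative, hence an absolutely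
continuous representative `q`, with which the equation holds pointwise. For continuous `f` the
derivative of `q` is continuous, which the maximum principle uses. -/
theorem IsWeakSolution.exists_isPrim (hab : a < b) (hσ : 0 < σ) (hφ : IsJumpDensity φ)
    (hf : MemL2 a b f) (h : IsWeakSolution a b σ μ lam φ f v) :
    ∃ q, IsPrim a b v q ∧
      IsPrim a b q (fun x => -(2 / σ ^ 2) * (f x - μ * (x * q x) + jumpOp lam φ v x)) := by
  have pv := h.1.isPrim hab
  have mj := h.1.memL2_jumpOp (lam := lam) hab.le hφ
  have hw : IsWeakDeriv a b (weakDeriv a b v)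
      (fun x => -(2 / σ ^ 2) * (f x - μ * (x * weakDeriv a b v x) + jumpOp lam φ v x)) := by
    refine ⟨((hf.sub (pv.memL2.id_mul.const_mul μ)).add mj).const_mul _, fun ψ h1 h2 h3 => ?_⟩
    have hψ := memH10_of_test hab.le h1 h3
    have mψ : MemL2 a b ψ := memL2_of_continuousOn h1.continuous.continuousOn
    have e := h.2 ψ hψ
    rw [bilin_eq hab.le pv (isPrim_of_contDiff h1), l2inner] at e
    have i1 := hf.mul hab.le mψ
    have i2 := (pv.memL2.id_mul.mul hab.le mψ).const_mul μ
    have i3 := mj.mul hab.le mψ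
    have e2 : ∫ x in a..b,
        -(2 / σ ^ 2) * (f x - μ * (x * weakDeriv a b v x) + jumpOp lam φ v x) * ψ x
        = -(2 / σ ^ 2) * ((∫ x in a..b, f x * ψ x)
          - μ * (∫ x in a..b, x * weakDeriv a b v x * ψ x)
          + ∫ x in a..b, jumpOp lam φ v x * ψ x) := by
      rw [← intervalIntegral.integral_const_mul, ← intervalIntegral.integral_sub i1 i2,
        ← intervalIntegral.integral_add (i1.sub i2) i3, ← intervalIntegral.integral_const_mul]
      congr 1; ext x; ring
    rw [e2, ← e]
    field_simp
    ring
  obtain ⟨q, hq, e⟩ := hw.exists_isPrim hab (pv.memL2.intervalIntegrable hab.le)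
  refine ⟨q, pv.congr_right e, hq.congr_right ?_⟩
  filter_upwards [e] with x hx
  rw [hx]

/-- In the adjoint equation it is the flux `σ²/2 w' + μ x w` that has a weak derivative. Solving for
`w'` and differentiating `x w` produces the extra term `μ w`. -/
theorem IsAdjointWeakSolution.exists_isPrim (hab : a < b) (hσ : 0 < σ) (hφ : IsJumpDensity φ)
    (hg : MemL2 a b g) (h : IsAdjointWeakSolution a b σ μ lam φ g w) :
    ∃ q, IsPrim a b w q ∧
      IsPrim a b q
        (fun x => -(2 / σ ^ 2) * (g x + jumpOp lam φ w x + μ * w x + μ * (x * q x))) := by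
  have pw := h.1.isPrim hab
  have mw := pw.memL2_left hab.le
  have mj := h.1.memL2_jumpOp (lam := lam) hab.le hφ
  have mp : MemL2 a b (fun x => σ ^ 2 / 2 * weakDeriv a b w x + μ * (x * w x)) :=
    (pw.memL2.const_mul _).add (mw.id_mul.const_mul μ)
  have hw : IsWeakDeriv a b (fun x => σ ^ 2 / 2 * weakDeriv a b w x + μ * (x * w x))
      (fun x => -(g x + jumpOp lam φ w x)) := by
    refine ⟨(hg.add mj).neg, fun ψ h1 h2 h3 => ?_⟩
    have hψ := memH10_of_test hab.le h1 h3
    have pψ : IsPrim a b ψ (deriv ψ) := isPrim_of_contDiff h1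
    have mψ := pψ.memL2_left hab.le
    have e := h.2 ψ hψ
    rw [bilin_eq hab.le pψ pw, l2inner, hψ.integral_jumpOp_mul_comm hab.le hφ h.1] at e
    have i1 := hg.mul hab.le mψ
    have i2 := mj.mul hab.le mψ
    have i3 := (pψ.memL2.mul hab.le pw.memL2).const_mul (σ ^ 2 / 2)
    have i4 := (pψ.memL2.id_mul.mul hab.le mw).const_mul μ
    have e1 : ∫ x in a..b, -(g x + jumpOp lam φ w x) * ψ x
        = -((∫ x in a..b, ψ x * g x) + ∫ x in a..b, jumpOp lam φ w x * ψ x) := by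
      simp only [mul_comm (ψ _)]
      rw [← intervalIntegral.integral_add i1 i2, ← intervalIntegral.integral_neg]
      congr 1; ext x; ring
    have e2 : ∫ x in a..b, (σ ^ 2 / 2 * weakDeriv a b w x + μ * (x * w x)) * deriv ψ x
        = σ ^ 2 / 2 * (∫ x in a..b, deriv ψ x * weakDeriv a b w x)
          + μ * ∫ x in a..b, x * deriv ψ x * w x := by
      rw [← intervalIntegral.integral_const_mul, ← intervalIntegral.integral_const_mul,
        ← intervalIntegral.integral_add i3 i4]
      congr 1; ext x; ring
    rw [e1, e2]
    linarith
  obtain ⟨p, hp, e⟩ := hw.exists_isPrim hab (mp.intervalIntegrable hab.le)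
  have hid : IsPrim a b (fun x => x) (fun _ => 1) :=
    isPrim_of_hasDerivAt continuousOn_id (fun x _ => hasDerivAt_id x) continuousOn_const
  have hq := (hp.sub ((hid.mul hab.le pw).const_mul μ)).const_mul (2 / σ ^ 2)
  have e' : weakDeriv a b w =ᵐ[volume.restrict (Ioo a b)]
      fun x => 2 / σ ^ 2 * (p x - μ * (x * w x)) := by
    filter_upwards [e] with x hx
    rw [← hx]
    field_simp
    ring
  refine ⟨_, pw.congr_right e', hq.congr_right ?_⟩
  filter_upwards [e'] with x hx
  rw [hx]
  ring

theorem l2norm_deriv_sq_le (hab : a ≤ b) (h1 : IsPrim a b v q) (h2 : IsPrim a b q r)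
    (ha : v a = 0) (hb : v b = 0) : l2norm a b q ^ 2 ≤ l2norm a b r * l2norm a b v := by
  have e := h2.integral_mul hab h1
  rw [ha, hb] at e
  have := (abs_le.1 (abs_integral_mul_le hab h2.memL2 (h1.memL2_left hab))).1
  rw [l2norm_sq hab]
  simp only [pow_two]
  linarith

/-- The first order term is interpolated between `v''` and `v`. It returns half of `‖v''‖`, whose
absorption doubles the factor `2/σ²` to `4/σ²`. -/
theorem l2norm_second_deriv_le (hab : a ≤ b) (hσ : 0 < σ) (h1 : IsPrim a b v q)
    (h2 : IsPrim a b q r) (ha : v a = 0) (hb : v b = 0) {F K m : ℝ}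
    (h : l2norm a b r ≤ 2 / σ ^ 2 * (F + m * l2norm a b q + K * l2norm a b v)) :
    l2norm a b r ≤ 4 / σ ^ 2 * (F + (K + m ^ 2 / σ ^ 2) * l2norm a b v) := by
  have hsq := l2norm_deriv_sq_le hab h1 h2 ha hb
  have nr := l2norm_nonneg a b r
  have nv := l2norm_nonneg a b v
  set R := l2norm a b r
  set V := l2norm a b v
  set Q := l2norm a b q
  have hs : 0 < σ ^ 2 := by positivity
  -- Compare squares: `(A + B)² ≥ 4 A B`, and here `4 A B` equals `m² R V`, which dominates `m² Q²`.
  have hmQ : m * Q ≤ σ ^ 2 / 4 * R + m ^ 2 / σ ^ 2 * V := by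
    refine le_of_sq_le_sq ?_ (by positivity)
    have e : (σ ^ 2 / 4 * R + m ^ 2 / σ ^ 2 * V) ^ 2
        = (σ ^ 2 / 4 * R - m ^ 2 / σ ^ 2 * V) ^ 2 + m ^ 2 * (R * V) := by
      field_simp; ring
    rw [e, mul_pow]
    nlinarith [sq_nonneg (σ ^ 2 / 4 * R - m ^ 2 / σ ^ 2 * V),
      mul_le_mul_of_nonneg_left hsq (sq_nonneg m)]
  rw [div_mul_eq_mul_div, le_div_iff₀ hs] at h ⊢
  nlinarith

theorem IsWeakSolution.regularity (hab : a < b) (hσ : 0 < σ) (hμ : 0 < μ) (hlam : 0 < lam)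
    (hφ : IsJumpDensity φ) (hf : MemL2 a b f) (h : IsWeakSolution a b σ μ lam φ f v) :
    MemH2 a b v ∧ l2norm a b (weakDeriv a b (weakDeriv a b v))
      ≤ c7 σ * l2norm a b f + c8 a b σ μ lam * l2norm a b v := by
  obtain ⟨q, h1, h2⟩ := h.exists_isPrim hab hσ hφ hf
  obtain ⟨h3, h4⟩ := h1.memH2 hab.le h2
  refine ⟨h3, ?_⟩
  rw [h4]
  have mj := h.1.memL2_jumpOp (lam := lam) hab.le hφ
  have mq := h1.memL2.id_mul.const_mul μ
  refine (l2norm_second_deriv_le (F := l2norm a b f) (K := 2 * lam) (m := μ * max |a| |b|)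
    hab.le hσ h1 h2 h.1.left h.1.right ?_).trans ?_
  · rw [l2norm_const_mul, abs_neg, abs_of_pos (by positivity)]
    refine mul_le_mul_of_nonneg_left ?_ (by positivity)
    refine (l2norm_add_le hab.le (hf.sub mq) mj).trans
      (add_le_add ((l2norm_sub_le hab.le hf mq).trans (add_le_add le_rfl ?_))
        (h.1.l2norm_jumpOp_le hab.le hφ hlam.le))
    rw [l2norm_const_mul, abs_of_pos hμ, mul_assoc]
    exact mul_le_mul_of_nonneg_left (l2norm_id_mul_le hab.le h1.memL2) hμ.le
  -- The summand `μ` in `c8` is needed for the adjoint problem only; here it is slack.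
  · have : 0 ≤ 4 / σ ^ 2 * μ * l2norm a b v :=
      mul_nonneg (by positivity) (l2norm_nonneg _ _ _)
    have e : c7 σ * l2norm a b f + c8 a b σ μ lam * l2norm a b v
        = 4 / σ ^ 2 * (l2norm a b f + (2 * lam + (μ * max |a| |b|) ^ 2 / σ ^ 2) * l2norm a b v)
          + 4 / σ ^ 2 * μ * l2norm a b v := by
      rw [c7, c8]; ring
    linarith

theorem IsAdjointWeakSolution.regularity (hab : a < b) (hσ : 0 < σ) (hμ : 0 < μ)
    (hlam : 0 < lam) (hφ : IsJumpDensity φ) (hg : MemL2 a b g)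
    (h : IsAdjointWeakSolution a b σ μ lam φ g w) :
    MemH2 a b w ∧ l2norm a b (weakDeriv a b (weakDeriv a b w))
      ≤ c7 σ * l2norm a b g + c8 a b σ μ lam * l2norm a b w := by
  obtain ⟨q, h1, h2⟩ := h.exists_isPrim hab hσ hφ hg
  obtain ⟨h3, h4⟩ := h1.memH2 hab.le h2
  refine ⟨h3, ?_⟩
  rw [h4]
  have mj := h.1.memL2_jumpOp (lam := lam) hab.le hφ
  have mq := h1.memL2.id_mul.const_mul μ
  have mw := (h1.memL2_left hab.le).const_mul μ
  refine (l2norm_second_deriv_le (F := l2norm a b g) (K := 2 * lam + μ) (m := μ * max |a| |b|)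
    hab.le hσ h1 h2 h.1.left h.1.right ?_).trans ?_
  · rw [l2norm_const_mul, abs_neg, abs_of_pos (by positivity)]
    refine mul_le_mul_of_nonneg_left ?_ (by positivity)
    have t1 := l2norm_add_le hab.le ((hg.add mj).add mw) mq
    have t2 := l2norm_add_le hab.le (hg.add mj) mw
    have t3 := l2norm_add_le hab.le hg mj
    have t4 := h.1.l2norm_jumpOp_le hab.le hφ hlam.le
    have t5 := mul_le_mul_of_nonneg_left (l2norm_id_mul_le hab.le h1.memL2) hμ.le
    rw [l2norm_const_mul, abs_of_pos hμ] at t1 t2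
    linarith
  · refine le_of_eq ?_
    rw [c7, c8]; ring

/-! ### The maximum principle -/

theorem IsPrim.hasDerivAt (hab : a ≤ b) (h : IsPrim a b v g) (hg : ContinuousOn g (Icc a b))
    {x : ℝ} (hx : x ∈ Ioo a b) : HasDerivAt v (g x) x := by
  have hi := (h.memL2.intervalIntegrable hab).mono_set (c := a) (d := x) (by
    rw [uIcc_of_le hab, uIcc_of_le hx.1.le]; exact Icc_subset_Icc le_rfl hx.2.le)
  have hc : ContinuousAt g x := hg.continuousAt (Icc_mem_nhds hx.1 hx.2)
  have hm : StronglyMeasurableAtFilter g (nhds x) :=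
    (hg.mono Ioo_subset_Icc_self).stronglyMeasurableAtFilter isOpen_Ioo x hx
  have := (intervalIntegral.integral_hasDerivAt_right hi hm hc).const_add (v a)
  refine this.congr_of_eventuallyEq ?_
  filter_upwards [Ioo_mem_nhds hx.1 hx.2] with y hy
  exact h.eq_add y (Ioo_subset_Icc_self hy)

theorem second_deriv_nonpos_of_isMax (h1 : ∀ x ∈ Ioo a b, HasDerivAt v (q x) x)
    (h2 : ∀ x ∈ Ioo a b, HasDerivAt q (r x) x) {x : ℝ} (hx : x ∈ Ioo a b)
    (hmax : ∀ y ∈ Ioo a b, v y ≤ v x) : q x = 0 ∧ r x ≤ 0 := by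
  have hn : Ioo a b ∈ nhds x := Ioo_mem_nhds hx.1 hx.2
  have hlm : IsLocalMax v x := Filter.eventually_of_mem hn hmax
  have hq := hlm.hasDerivAt_eq_zero (h1 x hx)
  refine ⟨hq, not_lt.1 fun hr => ?_⟩
  have hd : deriv v =ᶠ[nhds x] q := Filter.eventually_of_mem hn fun y hy => (h1 y hy).deriv
  have hr' : 0 < deriv (deriv v) x := by
    rw [hd.deriv_eq, (h2 x hx).deriv]; exact hr
  -- A positive second derivative would make `x` a local minimum as well, so `v` would be locally
  -- constant and its second derivative zero.
  have hmin := isLocalMin_of_deriv_deriv_pos hr' ((h1 x hx).deriv.trans hq)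
    (h1 x hx).continuousAt
  have hconst : v =ᶠ[nhds x] fun _ => v x := by
    filter_upwards [hlm, hmin] with y h3 h4
    exact le_antisymm h3 h4
  have e2 : deriv v =ᶠ[nhds x] fun _ => 0 := by
    have := hconst.deriv
    simpa using this
  have := e2.deriv_eq
  simp only [deriv_const] at this
  linarith

theorem gammaHat_pos (hσ : 0 < σ) (hlam : 0 < lam) : 0 < gammaHat b σ μ lam := by
  have hp : 0 < 2 * (lam + 1) / σ ^ 2 := by positivity
  have h : |μ * b / σ ^ 2| < Real.sqrt (2 * (lam + 1) / σ ^ 2 + (μ * b / σ ^ 2) ^ 2) := by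
    rw [← Real.sqrt_sq_eq_abs]
    exact Real.sqrt_lt_sqrt (sq_nonneg _) (by linarith)
  have := (abs_lt.1 h).1
  rw [gammaHat]; linarith

theorem gammaHat_eq (hσ : 0 < σ) (hlam : 0 < lam) :
    σ ^ 2 / 2 * gammaHat b σ μ lam ^ 2 - μ * b * gammaHat b σ μ lam - lam = 1 := by
  have hp : 0 ≤ 2 * (lam + 1) / σ ^ 2 + (μ * b / σ ^ 2) ^ 2 := by positivity
  have h := Real.sq_sqrt hp
  have e : gammaHat b σ μ lam - μ * b / σ ^ 2
      = Real.sqrt (2 * (lam + 1) / σ ^ 2 + (μ * b / σ ^ 2) ^ 2) := by rw [gammaHat]; ring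
  rw [← e] at h
  generalize gammaHat b σ μ lam = γ at h ⊢
  have hs : σ ≠ 0 := hσ.ne'
  field_simp at h ⊢
  have h3 : (γ * σ ^ 2 - μ * b) ^ 2 = (2 * (lam + 1) * σ ^ 2 + μ ^ 2 * b ^ 2) := by
    linarith
  have h4 : σ ^ 2 * (γ * (γ * σ ^ 2 - μ * b * 2) - 2 * (lam + 1)) = 0 := by linarith
  have h5 := (mul_eq_zero.1 h4).resolve_left (by positivity)
  linarith

theorem IsWeakSolution.sub (hab : a < b) (hφ : IsJumpDensity φ) (hf : MemL2 a b f)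
    (hg : MemL2 a b g) (h1 : IsWeakSolution a b σ μ lam φ f v)
    (h2 : IsWeakSolution a b σ μ lam φ g w) :
    IsWeakSolution a b σ μ lam φ (fun x => f x - g x) (fun x => v x - w x) := by
  refine ⟨h1.1.sub hab h2.1, fun ψ hψ => ?_⟩
  rw [bilin_sub_left hab hφ h1.1 h2.1 hψ, h1.2 ψ hψ, h2.2 ψ hψ]
  simp only [l2inner, sub_mul]
  rw [intervalIntegral.integral_sub (hf.mul hab.le hψ.memH1.1) (hg.mul hab.le hψ.memH1.1)]

theorem isWeakSolution_zero (hab : a < b) :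
    IsWeakSolution a b σ μ lam φ (fun _ => 0) (fun _ => 0) := by
  refine ⟨memH10_zero hab.le, fun ψ hψ => ?_⟩
  have := bilin_const_mul_left (σ := σ) (μ := μ) (lam := lam) (φ := φ) hab
    (memH10_zero hab.le) hψ 0
  simpa [l2inner] using this

theorem memL2_zero : MemL2 a b fun _ => 0 := memL2_of_continuousOn continuousOn_const

theorem IsWeakSolution.neg (hab : a < b) (hφ : IsJumpDensity φ) (hf : MemL2 a b f)
    (h : IsWeakSolution a b σ μ lam φ f v) :
    IsWeakSolution a b σ μ lam φ (fun x => -f x) (fun x => -v x) := by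
  simpa using (isWeakSolution_zero hab).sub hab hφ memL2_zero hf h

theorem jumpMean_le (hφ : IsJumpDensity φ) (hu : Continuous u) {C : ℝ} (h : ∀ x, u x ≤ C)
    (x : ℝ) : jumpMean φ u x ≤ C := by
  have iφ := hφ.continuous.integrable_of_hasCompactSupport (μ := volume) hφ.hasCompactSupport
  calc jumpMean φ u x ≤ ∫ y, C * φ y :=
        integral_mono (integrable_jumpMean hφ hu x) (iφ.const_mul C) fun y =>
          mul_le_mul_of_nonneg_right (h _) (hφ.nonneg y)
    _ = C := by rw [integral_const_mul, hφ.integral_eq_one, mul_one]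

/-- If `v` exceeded the barrier, the difference would have a positive maximum. It lies in the
interior, since the barrier is nonnegative and `v` vanishes on the boundary. There the first
derivatives agree and the second derivative of the difference is nonpositive, so the equation
together with the choice of `γ` forces `F exp (γ (y - a)) ≤ f y < F`, although the exponential is at
least one. -/
theorem IsWeakSolution.le_barrier (hab : a < b) (hσ : 0 < σ) (hμ : 0 < μ) (hlam : 0 < lam)
    (hφ : IsJumpDensity φ) (hf : ContinuousOn f (Icc a b))
    (h : IsWeakSolution a b σ μ lam φ f v) {F : ℝ} (hF0 : 0 < F) (hF : ∀ x ∈ Icc a b, f x < F)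
    {x : ℝ} (hx : x ∈ Icc a b) :
    v x ≤ F * (c4 a b σ μ lam - Real.exp (gammaHat b σ μ lam * (x - a))) := by
  obtain ⟨q, h1, h2⟩ := h.exists_isPrim hab hσ hφ (memL2_of_continuousOn hf)
  have hγ := gammaHat_pos (b := b) (μ := μ) hσ hlam
  have hγe := gammaHat_eq (b := b) (μ := μ) hσ hlam
  rw [c4]
  set γ := gammaHat b σ μ lam
  set p : ℝ → ℝ := fun x => Real.exp (γ * (x - a)) with hp
  have hpd : ∀ x, HasDerivAt p (γ * p x) x := fun x => by
    have e1 : HasDerivAt (fun x => γ * (x - a)) γ x := by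
      simpa using ((hasDerivAt_id x).sub_const a).const_mul γ
    simpa [hp, mul_comm] using e1.exp
  have hvc := h.1.continuous hab.le
  have hqc := h2.continuousOn hab.le
  have hrc : ContinuousOn (fun x => -(2 / σ ^ 2) * (f x - μ * (x * q x) + jumpOp lam φ v x))
      (Icc a b) := by
    have := (continuous_jumpOp (lam := lam) hφ hvc).continuousOn (s := Icc a b)
    exact continuousOn_const.mul ((hf.sub (continuousOn_const.mul (continuousOn_id.mul hqc))).add
      this)
  have hpc : Continuous p := continuous_iff_continuousAt.2 fun x => (hpd x).continuousAt
  have hpb : p b = Real.exp (γ * (b - a)) := rfl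
  rw [← hpb]
  have hmono : ∀ x ≤ b, p x ≤ p b := fun x hx =>
    Real.exp_le_exp.2 (mul_le_mul_of_nonneg_left (by linarith) hγ.le)
  have hone : ∀ x, a ≤ x → 1 ≤ p x := fun x hx =>
    Real.one_le_exp (mul_nonneg hγ.le (by linarith))
  by_contra hcon
  rw [not_le] at hcon
  obtain ⟨y, hy, hmax⟩ := isCompact_Icc.exists_isMaxOn ⟨x, hx⟩
    (f := fun x => v x - F * (p b - p x))
    (hvc.sub (continuous_const.mul (continuous_const.sub hpc))).continuousOn
  have hmax' : ∀ t ∈ Icc a b, v t - F * (p b - p t) ≤ v y - F * (p b - p y) := fun t ht => hmax ht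
  have hpos : 0 < v y - F * (p b - p y) := by
    have := hmax' x hx
    have : F * (p b - p x) < v x := hcon
    linarith
  have hF1 : 0 ≤ F * (p b - p y) := mul_nonneg hF0.le (by linarith [hmono y hy.2])
  have hvy : 0 < v y := by linarith
  have hyI : y ∈ Ioo a b := by
    by_contra hy'
    rw [h.1.eq_zero y hy'] at hvy
    exact lt_irrefl _ hvy
  obtain ⟨e1, e2⟩ := second_deriv_nonpos_of_isMax
    (v := fun x => v x - F * (p b - p x)) (q := fun x => q x + F * (γ * p x))
    (r := fun x => -(2 / σ ^ 2) * (f x - μ * (x * q x) + jumpOp lam φ v x)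
      + F * (γ * (γ * p x)))
    (fun t ht => by
      have := (h1.hasDerivAt hab.le hqc ht).sub (((hpd t).const_sub (p b)).const_mul F)
      convert! this using 1
      ring)
    (fun t ht => (h2.hasDerivAt hab.le hrc ht).add (((hpd t).const_mul γ).const_mul F))
    hyI (fun t ht => hmax' t (Ioo_subset_Icc_self ht))
  have hpy : 0 < p y := Real.exp_pos _
  have hJ : jumpOp lam φ v y ≤ lam * (F * p y) := by
    rw [jumpOp_eq hφ hvc]
    refine mul_le_mul_of_nonneg_left ?_ hlam.le
    -- The jumps see all of `ℝ`: inside `(a,b)` the bound comes from maximality at `y`, outside from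
    -- `v = 0 < v y`.
    have := jumpMean_le hφ hvc (C := v y + F * p y) (fun t => ?_) y
    · linarith
    · by_cases ht : t ∈ Ioo a b
      · have h3 := hmax' t (Ioo_subset_Icc_self ht)
        have h4 : 0 < F * p t := mul_pos hF0 (Real.exp_pos _)
        linarith
      · rw [h.1.eq_zero t ht]
        positivity
  have hfy := hF y hy
  have hq : q y = -(F * (γ * p y)) := by linarith
  rw [hq] at e2
  have e3 : F * (γ * (γ * p y)) * σ ^ 2
      ≤ 2 * (f y - μ * (y * -(F * (γ * p y))) + jumpOp lam φ v y) := by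
    have : F * (γ * (γ * p y))
        ≤ 2 / σ ^ 2 * (f y - μ * (y * -(F * (γ * p y))) + jumpOp lam φ v y) := by linarith
    rwa [div_mul_eq_mul_div, le_div_iff₀ (by positivity)] at this
  have e4 : μ * γ * (F * p y) * y ≤ μ * γ * (F * p y) * b :=
    mul_le_mul_of_nonneg_left hy.2 (by positivity)
  -- The root `γ` is chosen so that diffusion beats drift and jumps by exactly one; the drift is
  -- estimated by its value at `b`.
  have e5 : F * p y * (σ ^ 2 / 2 * γ ^ 2 - μ * b * γ - lam) = F * p y := by rw [hγe, mul_one]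
  have e6 : F ≤ F * p y := le_mul_of_one_le_right hF0.le (hone y hy.1)
  linarith

theorem IsWeakSolution.le_c4_mul (hab : a < b) (hσ : 0 < σ) (hμ : 0 < μ) (hlam : 0 < lam)
    (hφ : IsJumpDensity φ) (hf : ContinuousOn f (Icc a b))
    (h : IsWeakSolution a b σ μ lam φ f v) {F : ℝ} (hF0 : 0 ≤ F) (hF : ∀ x ∈ Icc a b, f x ≤ F)
    (x : ℝ) : v x ≤ c4 a b σ μ lam * F := by
  have hc4 : 0 < c4 a b σ μ lam := Real.exp_pos _
  by_cases hx : x ∈ Icc a b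
  -- The barrier needs a strict, positive bound for `f`, so `F` is raised slightly.
  · refine le_of_forall_pos_le_add fun ε hε => ?_
    have h1 := h.le_barrier hab hσ hμ hlam hφ hf (F := F + ε / c4 a b σ μ lam) (by positivity)
      (fun y hy => (hF y hy).trans_lt (lt_add_of_pos_right _ (by positivity))) hx
    have h2 : (F + ε / c4 a b σ μ lam) * c4 a b σ μ lam = c4 a b σ μ lam * F + ε := by
      field_simp
    have h3 : 0 ≤ (F + ε / c4 a b σ μ lam) * Real.exp (gammaHat b σ μ lam * (x - a)) := by
      positivity
    linarith
  · rw [h.1.eq_zero x fun h' => hx (Ioo_subset_Icc_self h')]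
    positivity

/-- The maximum norm estimate. -/
theorem IsWeakSolution.abs_le (hab : a < b) (hσ : 0 < σ) (hμ : 0 < μ) (hlam : 0 < lam)
    (hφ : IsJumpDensity φ) (hf : ContinuousOn f (Icc a b))
    (h : IsWeakSolution a b σ μ lam φ f v) {F : ℝ} (hF0 : 0 ≤ F)
    (hF : ∀ x ∈ Icc a b, |f x| ≤ F) (x : ℝ) : |v x| ≤ c4 a b σ μ lam * F := by
  refine _root_.abs_le.2 ⟨?_, h.le_c4_mul hab hσ hμ hlam hφ hf hF0 (fun y hy => (_root_.abs_le.1 (hF y hy)).2) x⟩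
  have := (h.neg hab hφ (memL2_of_continuousOn hf)).le_c4_mul hab hσ hμ hlam hφ hf.neg hF0
    (fun y hy => neg_le.1 (_root_.abs_le.1 (hF y hy)).1) x
  linarith

/-- The difference of two solutions has right-hand side zero, which is continuous even if `f` is
not, so the maximum norm estimate applies with bound zero. -/
theorem IsWeakSolution.unique (hab : a < b) (hσ : 0 < σ) (hμ : 0 < μ) (hlam : 0 < lam)
    (hφ : IsJumpDensity φ) (hf : MemL2 a b f) (h1 : IsWeakSolution a b σ μ lam φ f v)
    (h2 : IsWeakSolution a b σ μ lam φ f w) : v = w := by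
  have h := h1.sub hab hφ hf hf h2
  simp only [sub_self] at h
  ext x
  have := h.abs_le hab hσ hμ hlam hφ continuousOn_const le_rfl (by simp) x
  rw [mul_zero] at this
  exact sub_eq_zero.1 (abs_nonpos_iff.1 this)

/-! ### The Hilbert space of weak derivatives of functions in `H¹₀(a,b)` -/

/-- The Hilbert space `L₂(a,b)`. -/
abbrev L2 (a b : ℝ) : Type := Lp ℝ 2 (volume.restrict (Ioo a b))

/-- The class in `L₂(a,b)` of a square integrable function. -/
def MemL2.toL2 (hf : MemL2 a b f) : L2 a b := MemLp.toLp f hf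

theorem toL2_congr (hf : MemL2 a b f) (hg : MemL2 a b g)
    (h : f =ᵐ[volume.restrict (Ioo a b)] g) : hf.toL2 = hg.toL2 :=
  MemLp.toLp_congr _ _ h

theorem MemL2.coeFn_toL2 (hf : MemL2 a b f) : hf.toL2 =ᵐ[volume.restrict (Ioo a b)] f :=
  MemLp.coeFn_toLp hf

theorem norm_toL2 (hab : a ≤ b) (hf : MemL2 a b f) : ‖hf.toL2‖ = l2norm a b f :=
  (l2norm_eq_norm hab hf).symm

theorem inner_toL2 (hab : a ≤ b) (hf : MemL2 a b f) (hg : MemL2 a b g) :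
    inner ℝ hf.toL2 hg.toL2 = ∫ x in a..b, f x * g x :=
  (l2inner_eq_inner hab hf hg).symm

theorem toL2_eq_add (hf : MemL2 a b f) (hg : MemL2 a b g) (hk : MemL2 a b k)
    (h : k =ᵐ[volume.restrict (Ioo a b)] fun x => f x + g x) : hk.toL2 = hf.toL2 + hg.toL2 :=
  (toL2_congr hk (hf.add hg) h).trans (MemLp.toLp_add hf hg)

theorem toL2_eq_smul {s : ℝ} (hf : MemL2 a b f) (hk : MemL2 a b k)
    (h : k =ᵐ[volume.restrict (Ioo a b)] fun x => s * f x) : hk.toL2 = s • hf.toL2 :=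
  (toL2_congr hk (hf.const_mul s) h).trans (MemLp.toLp_const_smul s hf)

theorem memL2_one : MemL2 a b fun _ => 1 := memL2_of_continuousOn continuousOn_const

theorem memL2_coe (g : L2 a b) : MemL2 a b g := Lp.memLp g

theorem toL2_coe (g : L2 a b) : (memL2_coe g).toL2 = g := Lp.toLp_coeFn g _

/-- The elements of `L₂(a,b)` with vanishing mean value. -/
def meanZero (a b : ℝ) : Submodule ℝ (L2 a b) :=
  LinearMap.ker (innerSL ℝ ((memL2_one (a := a) (b := b)).toL2) : L2 a b →ₗ[ℝ] ℝ)

instance : CompleteSpace (meanZero a b) :=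
  (innerSL ℝ ((memL2_one (a := a) (b := b)).toL2)).isClosed_ker.completeSpace_coe

theorem toL2_mem_meanZero (hab : a ≤ b) (hg : MemL2 a b g) :
    hg.toL2 ∈ meanZero a b ↔ ∫ x in a..b, g x = 0 := by
  have e : hg.toL2 ∈ meanZero a b
    ↔ inner ℝ ((memL2_one (a := a) (b := b)).toL2) (hg.toL2) = 0 := Iff.rfl
  rw [e, inner_toL2 hab]
  simp only [one_mul]

theorem integral_eq_zero_of_meanZero (hab : a ≤ b) (g : meanZero a b) :
    ∫ x in a..b, (g : L2 a b) x = 0 := by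
  rw [← toL2_mem_meanZero hab (memL2_coe _)]
  rw [toL2_coe]
  exact g.2

/-- The primitive of `g` that vanishes at `a`, extended by zero. -/
def antideriv (a b : ℝ) (g : ℝ → ℝ) (x : ℝ) : ℝ :=
  (Ioo a b).indicator (fun x => ∫ t in a..x, g t) x

theorem antideriv_congr (h : g =ᵐ[volume.restrict (Ioo a b)] k) :
    antideriv a b g = antideriv a b k := by
  ext x
  by_cases hx : x ∈ Ioo a b
  · rw [antideriv, antideriv, indicator_of_mem hx, indicator_of_mem hx]
    exact intervalIntegral_congr_Ioo hx.1.le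
      (ae_restrict_of_ae_restrict_of_subset (Ioo_subset_Ioo le_rfl hx.2.le) h)
  · rw [antideriv, antideriv, indicator_of_notMem hx, indicator_of_notMem hx]

theorem antideriv_add (hg : MemL2 a b g) (hk : MemL2 a b k) :
    antideriv a b (fun x => g x + k x) = fun x => antideriv a b g x + antideriv a b k x := by
  ext x
  by_cases hx : x ∈ Ioo a b
  · simp only [antideriv, indicator_of_mem hx]
    exact intervalIntegral.integral_add
      ((hg.mono le_rfl hx.2.le).intervalIntegrable hx.1.le)
      ((hk.mono le_rfl hx.2.le).intervalIntegrable hx.1.le)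
  · simp [antideriv, indicator_of_notMem hx]

theorem antideriv_const_mul (s : ℝ) (g : ℝ → ℝ) :
    antideriv a b (fun x => s * g x) = fun x => s * antideriv a b g x := by
  ext x
  by_cases hx : x ∈ Ioo a b
  · simp only [antideriv, indicator_of_mem hx, intervalIntegral.integral_const_mul]
  · simp [antideriv, indicator_of_notMem hx]

theorem isPrim_antideriv (hab : a ≤ b) (hg : MemL2 a b g) (h0 : ∫ x in a..b, g x = 0) :
    IsPrim a b (antideriv a b g) g := by
  refine (isPrim_integral hg).congr_left hab fun x hx => ?_
  by_cases hx' : x ∈ Ioo a b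
  · rw [antideriv, indicator_of_mem hx']
  · rw [antideriv, indicator_of_notMem hx']
    rcases eq_or_lt_of_le hx.1 with rfl | h1
    · rw [intervalIntegral.integral_same]
    · rcases eq_or_lt_of_le hx.2 with rfl | h2
      · rw [h0]
      · exact absurd ⟨h1, h2⟩ hx'

theorem memH10_antideriv (hab : a ≤ b) (hg : MemL2 a b g) (h0 : ∫ x in a..b, g x = 0) :
    MemH10 a b (antideriv a b g) :=
  (isPrim_antideriv hab hg h0).memH10 hab fun _ hx => indicator_of_notMem hx _

theorem MemH10.eq_antideriv (hab : a < b) (h : MemH10 a b v) :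
    v = antideriv a b (weakDeriv a b v) := by
  ext x
  by_cases hx : x ∈ Ioo a b
  · rw [antideriv, indicator_of_mem hx,
      (h.isPrim hab).eq_add x (Ioo_subset_Icc_self hx), h.left, zero_add]
  · rw [antideriv, indicator_of_notMem hx, h.eq_zero x hx]

theorem MemH10.integral_weakDeriv (hab : a < b) (h : MemH10 a b v) :
    ∫ x in a..b, weakDeriv a b v x = 0 := by
  rw [← (h.isPrim hab).sub_eq (left_mem_Icc.2 hab.le) (right_mem_Icc.2 hab.le), h.left, h.right,
    sub_zero]

/-- The element of `H¹₀(a,b)` with weak derivative `g`. -/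
def ofDeriv (g : meanZero a b) : ℝ → ℝ := antideriv a b (g : L2 a b)

theorem isPrim_ofDeriv (hab : a ≤ b) (g : meanZero a b) : IsPrim a b (ofDeriv g) (g : L2 a b) :=
  isPrim_antideriv hab (memL2_coe _) (integral_eq_zero_of_meanZero hab g)

theorem memH10_ofDeriv (hab : a ≤ b) (g : meanZero a b) : MemH10 a b (ofDeriv g) :=
  memH10_antideriv hab (memL2_coe _) (integral_eq_zero_of_meanZero hab g)

/-- The boundary value at `a` is built into the primitive and the one at `b` is the vanishing mean,
so testing with all of `H¹₀` amounts to testing with all of `meanZero`. -/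
theorem MemH10.exists_ofDeriv (hab : a < b) (h : MemH10 a b v) :
    ∃ g : meanZero a b, ofDeriv g = v := by
  have hm := (h.isPrim hab).memL2
  refine ⟨⟨hm.toL2, (toL2_mem_meanZero hab.le hm).2 (h.integral_weakDeriv hab)⟩, ?_⟩
  rw [ofDeriv, antideriv_congr hm.coeFn_toL2, ← h.eq_antideriv hab]

theorem ofDeriv_add (g k : meanZero a b) :
    ofDeriv (g + k) = fun x => ofDeriv g x + ofDeriv k x := by
  rw [ofDeriv, Submodule.coe_add, antideriv_congr (Lp.coeFn_add _ _)]
  exact antideriv_add (memL2_coe _) (memL2_coe _)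

theorem ofDeriv_smul (s : ℝ) (g : meanZero a b) :
    ofDeriv (s • g) = fun x => s * ofDeriv g x := by
  rw [ofDeriv, Submodule.coe_smul, antideriv_congr (Lp.coeFn_smul _ _)]
  exact antideriv_const_mul _ _

theorem l2norm_coe (hab : a ≤ b) (g : meanZero a b) : l2norm a b (g : L2 a b) = ‖g‖ := by
  rw [← norm_toL2 hab (memL2_coe _), toL2_coe, Submodule.coe_norm]

/-! ### The operators that represent the bilinear form -/

theorem memL2_ofDeriv (hab : a ≤ b) (g : meanZero a b) : MemL2 a b (ofDeriv g) :=
  (isPrim_ofDeriv hab g).memL2_left hab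

/-- The embedding of `H¹₀(a,b)` into `L₂(a,b)`. -/
def embed (hab : a < b) : meanZero a b →L[ℝ] L2 a b :=
  LinearMap.mkContinuous
    { toFun := fun g => (memL2_ofDeriv hab.le g).toL2
      map_add' := fun g k => by
        exact toL2_eq_add _ _ _ (Filter.EventuallyEq.of_eq (ofDeriv_add g k))
      map_smul' := fun s g => by
        exact toL2_eq_smul _ _ (Filter.EventuallyEq.of_eq (ofDeriv_smul s g)) }
    (c2 a b) fun g => by
      change ‖(memL2_ofDeriv hab.le g).toL2‖ ≤ _
      rw [norm_toL2 hab.le, ← l2norm_coe hab.le]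
      exact l2norm_le_c2_mul hab (isPrim_ofDeriv hab.le g) (memH10_ofDeriv hab.le g).left
        (memH10_ofDeriv hab.le g).right

theorem embed_apply (hab : a < b) (g : meanZero a b) :
    embed hab g = (memL2_ofDeriv hab.le g).toL2 := rfl

theorem memL2_lowerOrder (hab : a ≤ b) (hφ : IsJumpDensity φ) (g : meanZero a b) :
    MemL2 a b (fun x => μ * (x * (g : L2 a b) x) - jumpOp lam φ (ofDeriv g) x) :=
  ((memL2_coe _).id_mul.const_mul μ).sub ((memH10_ofDeriv hab g).memL2_jumpOp hab hφ)

/-- The part `v ↦ μ x v' - 𝓘 v` of the differential operator, as a function of `v'`. -/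
def lowerOrder (hab : a < b) (μ lam : ℝ) (hφ : IsJumpDensity φ) (hlam : 0 ≤ lam) :
    meanZero a b →L[ℝ] L2 a b :=
  LinearMap.mkContinuous
    { toFun := fun g => (memL2_lowerOrder (μ := μ) (lam := lam) hab.le hφ g).toL2
      map_add' := fun g k => by
        refine toL2_eq_add _ _ _ ?_
        filter_upwards [Lp.coeFn_add (g : L2 a b) k] with x hx
        rw [Submodule.coe_add, hx, ofDeriv_add, jumpOp_add hφ
          ((memH10_ofDeriv hab.le g).continuous hab.le)
          ((memH10_ofDeriv hab.le k).continuous hab.le)]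
        simp only [Pi.add_apply]
        ring
      map_smul' := fun s g => by
        refine toL2_eq_smul _ _ ?_
        filter_upwards [Lp.coeFn_smul s (g : L2 a b)] with x hx
        rw [Submodule.coe_smul, hx, ofDeriv_smul, jumpOp_const_mul]
        simp only [Pi.smul_apply, smul_eq_mul, RingHom.id_apply]
        ring }
    (|μ| * max |a| |b| + 2 * lam * c2 a b) fun g => by
      change ‖(memL2_lowerOrder hab.le hφ g).toL2‖ ≤ _
      have h10 := memH10_ofDeriv hab.le g
      have mj := h10.memL2_jumpOp (lam := lam) hab.le hφ
      rw [norm_toL2 hab.le, ← l2norm_coe hab.le]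
      refine (l2norm_sub_le hab.le ((memL2_coe _).id_mul.const_mul μ) mj).trans ?_
      rw [l2norm_const_mul, add_mul, mul_assoc, mul_assoc (2 * lam)]
      refine add_le_add (mul_le_mul_of_nonneg_left
        (l2norm_id_mul_le hab.le (memL2_coe _)) (abs_nonneg _))
        ((h10.l2norm_jumpOp_le hab.le hφ hlam).trans ?_)
      exact mul_le_mul_of_nonneg_left
        (l2norm_le_c2_mul hab (isPrim_ofDeriv hab.le g) h10.left h10.right) (by positivity)

/-- The operator on `H¹₀(a,b)` that represents the bilinear form. -/
def formOp (hab : a < b) (σ μ lam : ℝ) (hφ : IsJumpDensity φ) (hlam : 0 ≤ lam) :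
    meanZero a b →L[ℝ] meanZero a b :=
  (σ ^ 2 / 2) • 1 + ContinuousLinearMap.adjoint (embed hab) ∘L lowerOrder hab μ lam hφ hlam

theorem inner_embed (hab : a < b) (hf : MemL2 a b f) (g : meanZero a b) :
    inner ℝ (hf.toL2) (embed hab g) = l2inner a b f (ofDeriv g) := by
  rw [embed_apply, inner_toL2 hab.le, l2inner]

/-- The adjoint of the embedding moves L₂ pairings into the Hilbert space of derivatives. The weak
problem becomes the operator equation with right-hand side the adjoint embedding of `f`. -/
theorem inner_formOp (hab : a < b) (hφ : IsJumpDensity φ) (hlam : 0 ≤ lam) (g k : meanZero a b) :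
    inner ℝ (formOp hab σ μ lam hφ hlam g) k
      = bilin a b σ μ lam φ (ofDeriv g) (ofDeriv k) := by
  have pg := isPrim_ofDeriv hab.le g
  have pk := isPrim_ofDeriv hab.le k
  have mk := memL2_ofDeriv hab.le k
  have e1 : inner ℝ g k = ∫ x in a..b, (g : L2 a b) x * (k : L2 a b) x := by
    rw [Submodule.coe_inner, ← inner_toL2 hab.le (memL2_coe _) (memL2_coe _), toL2_coe,
      toL2_coe]
  have e2 : inner ℝ (lowerOrder hab μ lam hφ hlam g) (embed hab k)
      = μ * (∫ x in a..b, x * (g : L2 a b) x * ofDeriv k x)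
        - ∫ x in a..b, jumpOp lam φ (ofDeriv g) x * ofDeriv k x := by
    refine (inner_embed hab (memL2_lowerOrder hab.le hφ g) k).trans ?_
    rw [l2inner, ← intervalIntegral.integral_const_mul, ← intervalIntegral.integral_sub
      ((pg.memL2.id_mul.mul hab.le mk).const_mul μ)
      (((memH10_ofDeriv hab.le g).memL2_jumpOp hab.le hφ).mul hab.le mk)]
    congr 1; ext x; ring
  rw [formOp, add_apply, inner_add_left, smul_apply,
    one_apply_eq_self, real_inner_smul_left, ContinuousLinearMap.comp_apply,
    ContinuousLinearMap.adjoint_inner_left, e1, e2, bilin_eq hab.le pg pk]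
  ring

/-- The embedding of `H¹₀(a,b)` into `L₂(a,b)` is compact. -/
theorem isCompactOperator_embed (hab : a < b) : IsCompactOperator (embed hab) := by
  have hL : 0 < b - a := sub_pos.2 hab
  rw [← ContinuousLinearMap.coe_coe, isCompactOperator_iff_image_ball_subset_compact _ one_pos]
  -- By Cauchy–Schwarz the primitives of the unit ball are Hölder continuous of exponent 1/2 with
  -- constant one. Such bounded families are compact by Arzelà–Ascoli, and uniform convergence
  -- implies convergence in L₂.
  let A : Set (BoundedContinuousFunction (Icc a b) ℝ) :=
    {F | ∀ x y : Icc a b, |F x - F y| ≤ Real.sqrt |(x : ℝ) - y|} ∩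
      {F | ∀ x : Icc a b, |F x| ≤ Real.sqrt (b - a)}
  have hA : IsCompact A := by
    refine BoundedContinuousFunction.arzela_ascoli₂ (Icc (-Real.sqrt (b - a)) (Real.sqrt (b - a)))
      isCompact_Icc A ?_ (fun F x hF => abs_le.1 (hF.2 x)) ?_
    · refine IsClosed.inter ?_ ?_
      · simp only [ofPred_forall]
        refine isClosed_iInter fun x => isClosed_iInter fun y => isClosed_le ?_ continuous_const
        exact ((continuous_eval_const x).sub (continuous_eval_const y)).abs
      · simp only [ofPred_forall]
        refine isClosed_iInter fun x => isClosed_le ?_ continuous_const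
        exact (continuous_eval_const x).abs
    · intro x
      rw [Metric.equicontinuousAt_iff_right]
      intro ε hε
      have hc : Filter.Tendsto (fun y : Icc a b => Real.sqrt |(x : ℝ) - y|) (nhds x) (nhds 0) := by
        have : Continuous fun y : Icc a b => Real.sqrt |(x : ℝ) - y| := by fun_prop
        simpa using this.tendsto x
      filter_upwards [hc.eventually (gt_mem_nhds hε)] with y hy F
      rw [Real.dist_eq]
      exact (F.2.1 x y).trans_lt hy
  have hm : ∀ F : BoundedContinuousFunction (Icc a b) ℝ,
      MemL2 a b (fun x => F (projIcc a b hab.le x)) := fun F =>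
    memL2_of_continuousOn (F.continuous.comp continuous_projIcc).continuousOn
  let j : BoundedContinuousFunction (Icc a b) ℝ → L2 a b := fun F => (hm F).toL2
  have hj : Continuous j := by
    refine (LipschitzWith.of_dist_le_mul (K := (Real.sqrt (b - a)).toNNReal)
      fun F G => ?_).continuous
    rw [Real.coe_toNNReal _ (Real.sqrt_nonneg _), dist_eq_norm]
    have e : j F - j G = ((hm F).sub (hm G)).toL2 := (MemLp.toLp_sub (hm F) (hm G)).symm
    rw [e, norm_toL2 hab.le]
    have h1 := l2norm_le_of_abs_le hab.le ((hm F).sub (hm G))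
      (memL2_one.const_mul (dist F G)) fun x _ => by
        rw [mul_one, abs_of_nonneg dist_nonneg, ← Real.dist_eq]
        exact BoundedContinuousFunction.dist_coe_le_dist _
    rwa [l2norm_const_mul, l2norm_one, abs_of_nonneg dist_nonneg, mul_comm] at h1
  refine ⟨j '' A, hA.image hj, ?_⟩
  rintro _ ⟨g, hg, rfl⟩
  have hg1 : l2norm a b (g : L2 a b) ≤ 1 := by
    rw [l2norm_coe hab.le]
    exact (mem_ball_zero_iff.1 hg).le
  have pg := isPrim_ofDeriv hab.le g
  have hsub : ∀ x y : ℝ, x ∈ Icc a b → y ∈ Icc a b → x ≤ y →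
      |ofDeriv g y - ofDeriv g x| ≤ Real.sqrt (y - x) := by
    intro x y hx hy hxy
    rw [pg.sub_eq hx hy]
    refine (abs_integral_le hxy (pg.memL2.mono hx.1 hy.2)).trans
      (mul_le_of_le_one_right (Real.sqrt_nonneg _) ?_)
    exact (l2norm_mono hab.le hx.1 hxy hy.2 pg.memL2).trans hg1
  have hsub' : ∀ x y : Icc a b, |ofDeriv g x - ofDeriv g y| ≤ Real.sqrt |(x : ℝ) - y| := by
    intro x y
    rcases le_total (x : ℝ) y with h | h
    · rw [abs_sub_comm (ofDeriv g x), abs_sub_comm (x : ℝ), abs_of_nonneg (sub_nonneg.2 h)]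
      exact hsub _ _ x.2 y.2 h
    · rw [abs_of_nonneg (sub_nonneg.2 h)]
      exact hsub _ _ y.2 x.2 h
  have hcont := (memH10_ofDeriv hab.le g).continuous hab.le
  refine ⟨BoundedContinuousFunction.mkOfCompact
    ⟨fun x : Icc a b => ofDeriv g x, hcont.comp continuous_subtype_val⟩, ⟨hsub', fun x => ?_⟩, ?_⟩
  · have h1 := hsub a x (left_mem_Icc.2 hab.le) x.2 x.2.1
    rw [(memH10_ofDeriv hab.le g).left, sub_zero] at h1
    exact h1.trans (Real.sqrt_le_sqrt (by linarith [x.2.2]))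
  · refine toL2_congr _ (memL2_ofDeriv hab.le g) ((ae_restrict_iff' measurableSet_Ioo).2
      (Filter.Eventually.of_forall fun x hx => ?_))
    change ofDeriv g (projIcc a b hab.le x) = ofDeriv g x
    rw [projIcc_of_mem hab.le (Ioo_subset_Icc_self hx)]

/-! ### Existence of weak solutions -/

theorem isUnit_formOp (hab : a < b) (hσ : 0 < σ) (hμ : 0 < μ) (hlam : 0 < lam)
    (hφ : IsJumpDensity φ) : IsUnit (formOp hab σ μ lam hφ hlam.le) := by
  set D := formOp hab σ μ lam hφ hlam.le with hD
  set V := embed hab with hV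
  have hVV : ∀ g k : meanZero a b, inner ℝ ((ContinuousLinearMap.adjoint V ∘L V) g) k
      = l2inner a b (ofDeriv g) (ofDeriv k) := fun g k => by
    rw [ContinuousLinearMap.comp_apply, ContinuousLinearMap.adjoint_inner_left]
    exact inner_embed hab (memL2_ofDeriv hab.le g) k
  -- Adding `μ (u,v)` more than compensates the `-μ/2 ‖u‖²` of Gårding, so the shifted operator is
  -- coercive with constant `σ²/2`.
  have hC : IsUnit (D + μ • (ContinuousLinearMap.adjoint V ∘L V)) := by
    refine ContinuousLinearMap.isUnit_of_forall_le_norm_inner_map _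
      (c := (σ ^ 2 / 2).toNNReal) (Real.toNNReal_pos.2 (by positivity)) fun g => ?_
    rw [Real.coe_toNNReal _ (by positivity)]
    have h10 := memH10_ofDeriv hab.le g
    have hg := garding (σ := σ) (μ := μ) hab hφ hlam.le h10
    rw [l2norm_congr hab.le ((isPrim_ofDeriv hab.le g).weakDeriv_ae_eq hab.le),
      l2norm_coe hab.le] at hg
    refine le_trans ?_ (le_abs_self _)
    rw [add_apply, inner_add_left, smul_apply,
      real_inner_smul_left, hVV, hD, inner_formOp]
    have e : l2inner a b (ofDeriv g) (ofDeriv g) = l2norm a b (ofDeriv g) ^ 2 := by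
      rw [l2norm_sq hab.le, l2inner]; simp only [pow_two]
    rw [e]
    nlinarith [mul_nonneg hμ.le (sq_nonneg (l2norm a b (ofDeriv g)))]
  obtain ⟨C, hC⟩ := hC
  set T : meanZero a b →L[ℝ] meanZero a b :=
    (↑C⁻¹ : meanZero a b →L[ℝ] meanZero a b) ∘L (μ • (ContinuousLinearMap.adjoint V ∘L V)) with hT
  have hTc : IsCompactOperator T := by
    have h1 : IsCompactOperator (ContinuousLinearMap.adjoint V ∘L V) :=
      (isCompactOperator_embed hab).clm_comp (ContinuousLinearMap.adjoint V)
    have h2 : IsCompactOperator (μ • (ContinuousLinearMap.adjoint V ∘L V)) := h1.smul μ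
    exact h2.clm_comp _
  have hDT : D = ↑C * (1 - T) := by
    have : (↑C : meanZero a b →L[ℝ] meanZero a b) * T
        = μ • (ContinuousLinearMap.adjoint V ∘L V) := by
      rw [hT]
      exact C.mul_inv_cancel_left _
    rw [mul_sub, mul_one, this, hC, add_sub_cancel_right]
  rw [hDT]
  refine C.isUnit.mul ?_
  -- Fredholm alternative for the compact `T`: either `1 - T` is invertible or `1` is an eigenvalue,
  -- and an eigenvector would be a nonzero solution of the homogeneous problem.
  rcases hTc.hasEigenvalue_or_mem_resolventSet (one_ne_zero (α := ℝ)) with h | h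
  · exfalso
    obtain ⟨g, hg⟩ := h.exists_hasEigenvector
    have hTg : T g = g := by simpa using hg.apply_eq_smul
    have hDg : D g = 0 := by
      rw [hDT, mul_apply_eq_comp, sub_apply,
        one_apply_eq_self, hTg, sub_self, map_zero]
    have hsol : IsWeakSolution a b σ μ lam φ (fun _ => 0) (ofDeriv g) := by
      refine ⟨memH10_ofDeriv hab.le g, fun ψ hψ => ?_⟩
      obtain ⟨k, rfl⟩ := hψ.exists_ofDeriv hab
      rw [← inner_formOp hab hφ hlam.le, ← hD, hDg, inner_zero_left]
      simp [l2inner]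
    have hz := hsol.unique hab hσ hμ hlam hφ memL2_zero (isWeakSolution_zero hab)
    have h1 := (isPrim_ofDeriv hab.le g).isWeakDeriv hab.le
    rw [hz] at h1
    have h2 := h1.ae_eq hab.le ((isPrim_const 0).isWeakDeriv hab.le)
    refine hg.2 (Subtype.ext (Lp.ext (h2.trans ?_)))
    exact (Lp.coeFn_zero _ _ _).symm
  · rw [spectrum.mem_resolventSet_iff] at h
    simpa using h

theorem exists_isWeakSolution (hab : a < b) (hσ : 0 < σ) (hμ : 0 < μ) (hlam : 0 < lam)
    (hφ : IsJumpDensity φ) (hf : MemL2 a b f) : ∃ v, IsWeakSolution a b σ μ lam φ f v := by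
  obtain ⟨g, hg⟩ := (ContinuousLinearMap.isUnit_iff_bijective.1
    (isUnit_formOp (φ := φ) hab hσ hμ hlam hφ)).2
    (ContinuousLinearMap.adjoint (embed hab) (hf.toL2))
  refine ⟨ofDeriv g, memH10_ofDeriv hab.le g, fun ψ hψ => ?_⟩
  obtain ⟨k, rfl⟩ := hψ.exists_ofDeriv hab
  rw [← inner_formOp hab hφ hlam.le, hg, ContinuousLinearMap.adjoint_inner_left, inner_embed]

theorem existsUnique_isAdjointWeakSolution (hab : a < b) (hσ : 0 < σ) (hμ : 0 < μ)
    (hlam : 0 < lam) (hφ : IsJumpDensity φ) (hg : MemL2 a b g) :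
    ∃! w, IsAdjointWeakSolution a b σ μ lam φ g w := by
  have hu : IsUnit (ContinuousLinearMap.adjoint (formOp hab σ μ lam hφ hlam.le)) := by
    have := (isUnit_formOp (φ := φ) hab hσ hμ hlam hφ).star
    rwa [ContinuousLinearMap.star_eq_adjoint] at this
  have hbij := ContinuousLinearMap.isUnit_iff_bijective.1 hu
  have hiff : ∀ k : meanZero a b, IsAdjointWeakSolution a b σ μ lam φ g (ofDeriv k) ↔
      ContinuousLinearMap.adjoint (formOp hab σ μ lam hφ hlam.le) k
        = ContinuousLinearMap.adjoint (embed hab) (hg.toL2) := by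
    intro k
    have e : ∀ m : meanZero a b, (inner ℝ m (ContinuousLinearMap.adjoint
        (formOp hab σ μ lam hφ hlam.le) k) = bilin a b σ μ lam φ (ofDeriv m) (ofDeriv k)) ∧
        inner ℝ m (ContinuousLinearMap.adjoint (embed hab) (hg.toL2))
          = l2inner a b (ofDeriv m) g := fun m => by
      rw [ContinuousLinearMap.adjoint_inner_right, inner_formOp,
        ContinuousLinearMap.adjoint_inner_right, real_inner_comm, inner_embed]
      exact ⟨rfl, by simp only [l2inner, mul_comm]⟩
    constructor
    · intro h
      refine ext_inner_left ℝ fun m => ?_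
      rw [(e m).1, (e m).2]
      exact h.2 _ (memH10_ofDeriv hab.le m)
    · intro h
      refine ⟨memH10_ofDeriv hab.le k, fun ψ hψ => ?_⟩
      obtain ⟨m, rfl⟩ := hψ.exists_ofDeriv hab
      rw [← (e m).1, ← (e m).2, h]
  obtain ⟨k, hk⟩ := hbij.2 (ContinuousLinearMap.adjoint (embed hab) (hg.toL2))
  refine ⟨ofDeriv k, (hiff k).2 hk, fun w hw => ?_⟩
  obtain ⟨m, rfl⟩ := hw.1.exists_ofDeriv hab
  rw [hbij.1 (((hiff m).1 hw).trans hk.symm)]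

/-! ### Stability estimates -/

/-- The `L₁` estimate for the adjoint problem, dual to the maximum norm estimate. -/
theorem IsAdjointWeakSolution.integral_abs_le (hab : a < b) (hσ : 0 < σ) (hμ : 0 < μ)
    (hlam : 0 < lam) (hφ : IsJumpDensity φ) (hg : MemL2 a b g)
    (h : IsAdjointWeakSolution a b σ μ lam φ g w) :
    ∫ x in a..b, |w x| ≤ c4 a b σ μ lam * ∫ x in a..b, |g x| := by
  have hwc := h.1.continuous hab.le
  have hc4 : 0 < c4 a b σ μ lam := Real.exp_pos _
  refine le_of_forall_pos_le_add fun δ hδ => ?_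
  -- The right-hand side `w / (|w| + ε)` is a continuous substitute for the sign of `w`, bounded by
  -- one. Paired with `w` it loses at most `ε` pointwise against `|w|`, hence `δ` in total.
  set ε := δ / (b - a) with hε
  have hεp : 0 < ε := div_pos hδ (sub_pos.2 hab)
  have hden : ∀ x, 0 < |w x| + ε := fun x => by positivity
  have hfc : Continuous fun x => w x / (|w x| + ε) :=
    hwc.div (hwc.abs.add continuous_const) fun x => (hden x).ne'
  have hf : MemL2 a b fun x => w x / (|w x| + ε) := memL2_of_continuousOn hfc.continuousOn
  obtain ⟨v, hv⟩ := exists_isWeakSolution hab hσ hμ hlam hφ hf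
  have hvb : ∀ x, |v x| ≤ c4 a b σ μ lam := fun x => by
    have := hv.abs_le hab hσ hμ hlam hφ hfc.continuousOn zero_le_one (fun y _ => by
      rw [abs_div, abs_of_pos (hden y), div_le_one (hden y)]
      linarith) x
    rwa [mul_one] at this
  have e : ∫ x in a..b, w x / (|w x| + ε) * w x = ∫ x in a..b, v x * g x :=
    (hv.2 w h.1).symm.trans (h.2 v hv.1)
  have hgi := (hg.intervalIntegrable hab.le).abs
  have h1 : ∫ x in a..b, v x * g x ≤ c4 a b σ μ lam * ∫ x in a..b, |g x| := by
    rw [← intervalIntegral.integral_const_mul]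
    refine intervalIntegral.integral_mono_on hab.le (hv.1.memH1.1.mul hab.le hg)
      (hgi.const_mul _) fun x _ => ?_
    calc v x * g x ≤ |v x * g x| := le_abs_self _
      _ = |v x| * |g x| := abs_mul _ _
      _ ≤ _ := mul_le_mul_of_nonneg_right (hvb x) (abs_nonneg _)
  have h2 : (∫ x in a..b, |w x|) - δ ≤ ∫ x in a..b, w x / (|w x| + ε) * w x := by
    have e3 : (∫ x in a..b, |w x|) - δ = ∫ x in a..b, (|w x| - ε) := by
      rw [intervalIntegral.integral_sub (hwc.abs.intervalIntegrable _ _)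
        intervalIntegrable_const, intervalIntegral.integral_const, smul_eq_mul, hε,
        mul_div_cancel₀ _ (sub_pos.2 hab).ne']
    rw [e3]
    refine intervalIntegral.integral_mono_on hab.le
      ((hwc.abs.sub continuous_const).intervalIntegrable _ _)
      ((hfc.mul hwc).intervalIntegrable _ _) fun x _ => ?_
    rw [div_mul_eq_mul_div, le_div_iff₀ (hden x), ← abs_mul_abs_self (w x)]
    nlinarith [sq_nonneg ε]
  linarith

theorem MemH10.abs_le (hab : a < b) (h : MemH10 a b v) (x : ℝ) :
    |v x| ≤ Real.sqrt (b - a) * l2norm a b (weakDeriv a b v) := by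
  by_cases hx : x ∈ Icc a b
  · have pv := h.isPrim hab
    have e := pv.sub_eq (left_mem_Icc.2 hab.le) hx
    rw [h.left, sub_zero] at e
    rw [e]
    exact (abs_integral_le hx.1 (pv.memL2.mono le_rfl hx.2)).trans
      (mul_le_mul (Real.sqrt_le_sqrt (by linarith [hx.2]))
        (l2norm_mono hab.le le_rfl hx.1 hx.2 pv.memL2) (l2norm_nonneg _ _ _) (Real.sqrt_nonneg _))
  · rw [h.eq_zero x fun h' => hx (Ioo_subset_Icc_self h'), abs_zero]
    exact mul_nonneg (Real.sqrt_nonneg _) (l2norm_nonneg _ _ _)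

/-- The `L₂` stability estimate for the adjoint problem. -/
theorem IsAdjointWeakSolution.l2norm_le_c6_mul (hab : a < b) (hσ : 0 < σ) (hμ : 0 < μ)
    (hlam : 0 < lam) (hφ : IsJumpDensity φ) (hg : MemL2 a b g)
    (h : IsAdjointWeakSolution a b σ μ lam φ g w) :
    l2norm a b w ≤ c6 a b σ μ lam * l2norm a b g := by
  have pw := h.1.isPrim hab
  have mw := h.1.memH1.1
  have hc4 : 0 < c4 a b σ μ lam := Real.exp_pos _
  have hL : 0 < b - a := sub_pos.2 hab
  have nD := l2norm_nonneg a b (weakDeriv a b w)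
  have nG := l2norm_nonneg a b g
  have nW := l2norm_nonneg a b w
  have h1 : ∫ x in a..b, |w x| ≤ c4 a b σ μ lam * (Real.sqrt (b - a) * l2norm a b g) :=
    (h.integral_abs_le hab hσ hμ hlam hφ hg).trans
      (mul_le_mul_of_nonneg_left (JumpOU.integral_abs_le hab.le hg) hc4.le)
  -- One factor `|w|` is bounded by its maximum, the other is integrated. Each costs `√(b - a)`,
  -- which explains `c5`.
  have h2 : l2norm a b w ^ 2
      ≤ c5 a b σ μ lam * l2norm a b (weakDeriv a b w) * l2norm a b g := by
    calc l2norm a b w ^ 2 = ∫ x in a..b, w x ^ 2 := l2norm_sq hab.le _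
      _ ≤ ∫ x in a..b, Real.sqrt (b - a) * l2norm a b (weakDeriv a b w) * |w x| := by
        refine intervalIntegral.integral_mono_on hab.le (mw.sq hab.le)
          ((mw.intervalIntegrable hab.le).abs.const_mul _) fun x _ => ?_
        rw [← sq_abs, pow_two]
        exact mul_le_mul_of_nonneg_right (h.1.abs_le hab x) (abs_nonneg _)
      _ = Real.sqrt (b - a) * l2norm a b (weakDeriv a b w) * ∫ x in a..b, |w x| :=
        intervalIntegral.integral_const_mul _ _
      _ ≤ Real.sqrt (b - a) * l2norm a b (weakDeriv a b w)
          * (c4 a b σ μ lam * (Real.sqrt (b - a) * l2norm a b g)) :=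
        mul_le_mul_of_nonneg_left h1 (by positivity)
      _ = Real.sqrt (b - a) * Real.sqrt (b - a) * c4 a b σ μ lam
          * l2norm a b (weakDeriv a b w) * l2norm a b g := by ring
      _ = _ := by rw [Real.mul_self_sqrt hL.le, c5]
  have h3 := garding (σ := σ) (μ := μ) hab hφ hlam.le h.1
  have h4 : bilin a b σ μ lam φ w w ≤ l2norm a b w * l2norm a b g := by
    rw [h.2 w h.1]
    exact integral_mul_le hab.le mw hg
  have h5 := h.1.l2norm_le hab
  rw [c6, mul_assoc]
  refine h5.trans (mul_le_mul_of_nonneg_left ?_ (c2_pos hab).le)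
  set D := l2norm a b (weakDeriv a b w)
  set W := l2norm a b w
  set G := l2norm a b g
  set C := c5 a b σ μ lam
  -- Young's inequality contributes a second `μ/2 W²` next to Gårding's. The sum `μ W²` is bounded
  -- by `h2`, not absorbed, so no smallness of `μ` is required.
  have hyoung : W * G ≤ μ / 2 * W ^ 2 + G ^ 2 / (2 * μ) := by
    have : μ / 2 * W ^ 2 + G ^ 2 / (2 * μ) - W * G = (μ * W - G) ^ 2 / (2 * μ) := by
      field_simp; ring
    have : 0 ≤ (μ * W - G) ^ 2 / (2 * μ) := by positivity
    linarith
  have hyoung2 : μ * (C * D * G) ≤ σ ^ 2 / 4 * D ^ 2 + μ ^ 2 * C ^ 2 / σ ^ 2 * G ^ 2 := by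
    have : σ ^ 2 / 4 * D ^ 2 + μ ^ 2 * C ^ 2 / σ ^ 2 * G ^ 2 - μ * (C * D * G)
        = (σ / 2 * D - μ * C / σ * G) ^ 2 := by
      field_simp; ring
    have : 0 ≤ (σ / 2 * D - μ * C / σ * G) ^ 2 := sq_nonneg _
    linarith
  have h6 : σ ^ 2 / 4 * D ^ 2 ≤ G ^ 2 / (2 * μ) + μ ^ 2 * C ^ 2 / σ ^ 2 * G ^ 2 := by
    have := mul_le_mul_of_nonneg_left h2 hμ.le
    linarith
  have h7 : D ^ 2 ≤ (2 / (σ ^ 2 * μ) + 4 * μ ^ 2 / σ ^ 4 * C ^ 2) * G ^ 2 := by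
    have e1 : D ^ 2 = 4 / σ ^ 2 * (σ ^ 2 / 4 * D ^ 2) := by field_simp
    have e2 : (2 / (σ ^ 2 * μ) + 4 * μ ^ 2 / σ ^ 4 * C ^ 2) * G ^ 2
        = 4 / σ ^ 2 * (G ^ 2 / (2 * μ) + μ ^ 2 * C ^ 2 / σ ^ 2 * G ^ 2) := by field_simp; ring
    rw [e1, e2]
    exact mul_le_mul_of_nonneg_left h6 (by positivity)
  have h8 := Real.sqrt_le_sqrt h7
  rwa [Real.sqrt_sq nD, Real.sqrt_mul (by positivity), Real.sqrt_sq nG] at h8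

/-- The `L₂` stability estimate. -/
theorem IsWeakSolution.l2norm_le_c6_mul (hab : a < b) (hσ : 0 < σ) (hμ : 0 < μ)
    (hlam : 0 < lam) (hφ : IsJumpDensity φ) (hf : MemL2 a b f)
    (h : IsWeakSolution a b σ μ lam φ f v) :
    l2norm a b v ≤ c6 a b σ μ lam * l2norm a b f := by
  have mv := h.1.memH1.1
  -- Solve the adjoint problem with right-hand side `v`; then `‖v‖² = A(v,w) = (f,w)`.
  obtain ⟨w, hw, -⟩ := existsUnique_isAdjointWeakSolution hab hσ hμ hlam hφ mv
  have e : l2norm a b v ^ 2 = ∫ x in a..b, f x * w x := by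
    rw [l2norm_sq hab.le]
    simp only [pow_two]
    exact (hw.2 v h.1).symm.trans (h.2 w hw.1)
  have h1 := integral_mul_le hab.le hf hw.1.memH1.1
  have h2 := mul_le_mul_of_nonneg_left (hw.l2norm_le_c6_mul hab hσ hμ hlam hφ mv)
    (l2norm_nonneg a b f)
  rcases (l2norm_nonneg a b v).eq_or_lt with h0 | h0
  · rw [← h0]
    exact mul_nonneg (mul_nonneg (c2_pos hab).le (Real.sqrt_nonneg _)) (l2norm_nonneg _ _ _)
  · refine le_of_mul_le_mul_right ?_ h0
    rw [← pow_two, e]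
    linarith

theorem isRegularityConst_c3 (hab : a < b) (hσ : 0 < σ) (hμ : 0 < μ) (hlam : 0 < lam)
    (hφ : IsJumpDensity φ) : IsRegularityConst a b σ μ lam φ (c3 a b σ μ lam) := by
  have hc8 : 0 ≤ c8 a b σ μ lam := by
    have hM : 0 ≤ max |a| |b| := (abs_nonneg a).trans (le_max_left _ _)
    rw [c8]; positivity
  constructor
  · intro f v hf h
    obtain ⟨h1, h2⟩ := h.regularity hab hσ hμ hlam hφ hf
    refine ⟨h1, h2.trans ?_⟩
    have := mul_le_mul_of_nonneg_left (h.l2norm_le_c6_mul hab hσ hμ hlam hφ hf) hc8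
    rw [c3]; linarith
  · intro g w hg h
    obtain ⟨h1, h2⟩ := h.regularity hab hσ hμ hlam hφ hg
    refine ⟨h1, h2.trans ?_⟩
    have := mul_le_mul_of_nonneg_left (h.l2norm_le_c6_mul hab hσ hμ hlam hφ hg) hc8
    rw [c3]; linarith
variable {N : ℕ} {x : ℕ → ℝ}

/-! ### Piecewise linear functions on a mesh -/

theorem IsMesh.pos (hab : a < b) (hm : IsMesh a b N x) : 0 < N := by
  rcases Nat.eq_zero_or_pos N with rfl | h
  · exact absurd (hm.left.symm.trans hm.right) hab.ne
  · exact h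

theorem IsMesh.mono (hm : IsMesh a b N x) {i j : ℕ} (hij : i ≤ j) (hj : j ≤ N) : x i ≤ x j := by
  induction j, hij using Nat.le_induction with
  | base => exact le_rfl
  | succ n _ ih => exact (ih (by omega)).trans (hm.lt n (by omega)).le

theorem IsMesh.left_le (hm : IsMesh a b N x) {j : ℕ} (hj : j ≤ N) : a ≤ x j := by
  rw [← hm.left]; exact hm.mono (Nat.zero_le j) hj

theorem IsMesh.le_right (hm : IsMesh a b N x) {j : ℕ} (hj : j ≤ N) : x j ≤ b := by
  rw [← hm.right]; exact hm.mono hj le_rfl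

theorem IsMesh.exists_cell (hab : a < b) (hm : IsMesh a b N x) {y : ℝ} (hy : y ∈ Icc a b) :
    ∃ j < N, y ∈ Icc (x j) (x (j + 1)) := by
  have key : ∀ n, 0 < n → n ≤ N → y ≤ x n → ∃ j < n, y ∈ Icc (x j) (x (j + 1)) := by
    intro n
    induction n with
    | zero => intro h; exact absurd h (lt_irrefl 0)
    | succ n ih =>
      intro _ hn hyn
      rcases le_or_gt (x n) y with h | h
      · exact ⟨n, n.lt_succ_self, h, hyn⟩
      · have hn0 : 0 < n := by
          rcases Nat.eq_zero_or_pos n with rfl | h'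
          · rw [hm.left] at h; exact absurd hy.1 (not_le.2 h)
          · exact h'
        obtain ⟨j, hj, hj'⟩ := ih hn0 (by omega) h.le
        exact ⟨j, by omega, hj'⟩
  exact key N (hm.pos hab) le_rfl (by rw [hm.right]; exact hy.2)

theorem isPrim_affine {α β : ℝ} (h : ∀ y ∈ Icc c d, v y = α + β * y) (hcd : c ≤ d) :
    IsPrim c d v fun _ => β := by
  have h1 : IsPrim c d (fun y => α + β * y) fun _ => β :=
    isPrim_of_hasDerivAt (by fun_prop)
      (fun y _ => by simpa using ((hasDerivAt_id y).const_mul β).const_add α) continuousOn_const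
  exact h1.congr_left hcd h

/-- Away from the countable set of nodes `v` is differentiable with the slope of its cell. The
fundamental theorem tolerates such an exceptional set for continuous functions. -/
theorem MemVh.isPrim_deriv (hab : a < b) (hm : IsMesh a b N x) (h : MemVh a b N x v) :
    IsPrim a b v (deriv v) := by
  have haff := h.affine
  choose! α β hαβ using haff
  have hd : ∀ j < N, ∀ y ∈ Ioo (x j) (x (j + 1)), HasDerivAt v (β j) y := by
    intro j hj y hy
    have h1 : HasDerivAt (fun y => α j + β j * y) (β j) y := by
      simpa using ((hasDerivAt_id y).const_mul (β j)).const_add (α j)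
    refine h1.congr_of_eventuallyEq ?_
    filter_upwards [Ioo_mem_nhds hy.1 hy.2] with z hz
    exact hαβ j hj z (Ioo_subset_Icc_self hz)
  have hcell : ∀ y ∈ Ioo a b \ range x, ∃ j < N, HasDerivAt v (β j) y := by
    intro y hy
    obtain ⟨j, hj, hyj⟩ := hm.exists_cell hab (Ioo_subset_Icc_self hy.1)
    refine ⟨j, hj, hd j hj y ⟨lt_of_le_of_ne hyj.1 ?_, lt_of_le_of_ne hyj.2 ?_⟩⟩
    · exact fun e => hy.2 ⟨j, e⟩
    · exact fun e => hy.2 ⟨j + 1, e.symm⟩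
  have hml : MemL2 a b (deriv v) := by
    refine MemLp.of_bound (measurable_deriv v).aestronglyMeasurable
      (∑ j ∈ Finset.range N, |β j|) ?_
    refine (ae_restrict_iff' measurableSet_Ioo).2 ?_
    have h0 : volume (range x) = 0 := (countable_range x).measure_zero _
    filter_upwards [measure_eq_zero_iff_ae_notMem.1 h0] with y hy hy'
    obtain ⟨j, hj, hj'⟩ := hcell y ⟨hy', hy⟩
    rw [hj'.deriv, Real.norm_eq_abs]
    exact Finset.single_le_sum (f := fun j => |β j|) (fun i _ => abs_nonneg _)
      (Finset.mem_range.2 hj)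
  refine ⟨hml, fun y hy => ?_⟩
  rw [MeasureTheory.integral_eq_of_hasDerivAt_off_countable_of_le v (deriv v) hy.1
    (countable_range x) (h.continuousOn.mono (Icc_subset_Icc le_rfl hy.2)) ?_
    ((hml.mono le_rfl hy.2).intervalIntegrable hy.1)]
  · ring
  · intro z hz
    obtain ⟨j, -, hj'⟩ := hcell z ⟨⟨hz.1.1, hz.1.2.trans_le hy.2⟩, hz.2⟩
    exact hj'.differentiableAt.hasDerivAt

theorem MemVh.memH10 (hab : a < b) (hm : IsMesh a b N x) (h : MemVh a b N x v) : MemH10 a b v :=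
  (h.isPrim_deriv hab hm).memH10 hab.le h.eq_zero

theorem memVh_zero : MemVh a b N x 0 :=
  ⟨continuousOn_const, fun _ _ => rfl, fun _ _ => ⟨0, 0, fun y _ => by simp⟩⟩

theorem MemVh.add (hv : MemVh a b N x v) (hw : MemVh a b N x w) : MemVh a b N x (v + w) := by
  refine ⟨hv.continuousOn.add hw.continuousOn, fun y hy => ?_, fun j hj => ?_⟩
  · rw [Pi.add_apply, hv.eq_zero y hy, hw.eq_zero y hy, add_zero]
  · obtain ⟨α, β, h1⟩ := hv.affine j hj
    obtain ⟨α', β', h2⟩ := hw.affine j hj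
    refine ⟨α + α', β + β', fun y hy => ?_⟩
    rw [Pi.add_apply, h1 y hy, h2 y hy]; ring

theorem MemVh.smul (hv : MemVh a b N x v) (s : ℝ) : MemVh a b N x (s • v) := by
  refine ⟨hv.continuousOn.const_smul s, fun y hy => ?_, fun j hj => ?_⟩
  · rw [Pi.smul_apply, hv.eq_zero y hy, smul_zero]
  · obtain ⟨α, β, h1⟩ := hv.affine j hj
    refine ⟨s * α, s * β, fun y hy => ?_⟩
    rw [Pi.smul_apply, h1 y hy, smul_eq_mul]; ring

/-- The finite element space. -/
def feSpace (a b : ℝ) (N : ℕ) (x : ℕ → ℝ) : Submodule ℝ (ℝ → ℝ) where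
  carrier := {v | MemVh a b N x v}
  zero_mem' := memVh_zero
  add_mem' := MemVh.add
  smul_mem' := fun s _ hv => MemVh.smul hv s

/-- An affine function with two zeros vanishes. Injectivity of the nodal values makes the finite
element space finite dimensional. -/
theorem MemVh.eq_zero_of_nodes (hab : a < b) (hm : IsMesh a b N x) (h : MemVh a b N x v)
    (h0 : ∀ j ≤ N, v (x j) = 0) : v = 0 := by
  ext y
  by_cases hy : y ∈ Ioo a b
  · obtain ⟨j, hj, hyj⟩ := hm.exists_cell hab (Ioo_subset_Icc_self hy)
    obtain ⟨α, β, hαβ⟩ := h.affine j hj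
    have hlt := hm.lt j hj
    have e1 := hαβ _ (left_mem_Icc.2 hlt.le)
    have e2 := hαβ _ (right_mem_Icc.2 hlt.le)
    rw [h0 j hj.le] at e1
    rw [h0 (j + 1) hj] at e2
    have hβ : β = 0 := by
      have : β * (x (j + 1) - x j) = 0 := by linarith
      exact (mul_eq_zero.1 this).resolve_right (sub_pos.2 hlt).ne'
    rw [hβ] at e1
    rw [hαβ y hyj, hβ, Pi.zero_apply]
    linarith
  · exact h.eq_zero y hy

theorem finiteDimensional_feSpace (hab : a < b) (hm : IsMesh a b N x) :
    FiniteDimensional ℝ (feSpace a b N x) := by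
  let L : feSpace a b N x →ₗ[ℝ] (Fin (N + 1) → ℝ) :=
    { toFun := fun v j => (v : ℝ → ℝ) (x j)
      map_add' := fun _ _ => rfl
      map_smul' := fun _ _ => rfl }
  refine FiniteDimensional.of_injective L ((injective_iff_map_eq_zero L).2 fun v hv => ?_)
  refine Subtype.ext (MemVh.eq_zero_of_nodes hab hm v.2 fun j hj => ?_)
  exact congrFun hv ⟨j, Nat.lt_succ_of_le hj⟩

/-- Uniqueness implies existence for the finite element equations. -/
theorem exists_isFEMSolution (hab : a < b) (hφ : IsJumpDensity φ) (hm : IsMesh a b N x)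
    (hf : MemL2 a b f)
    (huniq : ∀ v, IsFEMSolution a b σ μ lam φ (fun _ => 0) N x v → v = 0) :
    ∃ v, IsFEMSolution a b σ μ lam φ f N x v := by
  have := finiteDimensional_feSpace hab hm
  have h10 : ∀ v : feSpace a b N x, MemH10 a b v := fun v => MemVh.memH10 hab hm v.2
  let B : feSpace a b N x →ₗ[ℝ] Module.Dual ℝ (feSpace a b N x) :=
    LinearMap.mk₂ ℝ (fun u v => bilin a b σ μ lam φ u v)
      (fun u w v => bilin_add_left hab hφ (h10 u) (h10 w) (h10 v))
      (fun s u v => bilin_const_mul_left hab (h10 u) (h10 v) s)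
      (fun u v w => bilin_add_right hab hφ (h10 u) (h10 w) (h10 v))
      (fun s u v => bilin_const_mul_right hab (h10 u) (h10 v) s)
  let F : Module.Dual ℝ (feSpace a b N x) :=
    { toFun := fun v => l2inner a b f v
      map_add' := fun v w => by
        simp only [l2inner, Submodule.coe_add, Pi.add_apply, mul_add]
        exact intervalIntegral.integral_add (hf.mul hab.le (h10 v).memH1.1)
          (hf.mul hab.le (h10 w).memH1.1)
      map_smul' := fun s v => by
        simp only [l2inner, Submodule.coe_smul, Pi.smul_apply, smul_eq_mul, RingHom.id_apply,
          mul_left_comm _ s, intervalIntegral.integral_const_mul] }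
  have hinj : Function.Injective B := by
    refine (injective_iff_map_eq_zero B).2 fun v hv => Subtype.ext (huniq v ⟨v.2, fun ψ hψ => ?_⟩)
    have : B v ⟨ψ, hψ⟩ = 0 := by rw [hv]; rfl
    exact this.trans (by simp [l2inner])
  obtain ⟨v, hv⟩ := (LinearMap.injective_iff_surjective_of_finrank_eq_finrank
    (Subspace.dual_finrank_eq (K := ℝ) (V := feSpace a b N x)).symm).1 hinj F
  exact ⟨v, v.2, fun ψ hψ => LinearMap.congr_fun hv ⟨ψ, hψ⟩⟩

/-! ### Interpolation -/

/-- The piecewise linear function with the values of `w` in the nodes of the mesh. -/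
def nodalInterp (N : ℕ) (x : ℕ → ℝ) (w : ℝ → ℝ) (y : ℝ) : ℝ :=
  ∑ j ∈ Finset.range N, (w (x (j + 1)) - w (x j)) / (x (j + 1) - x j)
    * max 0 (min (y - x j) (x (j + 1) - x j))

theorem continuous_nodalInterp : Continuous (nodalInterp N x w) := by
  unfold nodalInterp
  fun_prop

/-- The ramps of earlier cells are saturated and telescope to `w (x i) - w a`, with `w a = 0`; those
of later cells are still zero. -/
theorem nodalInterp_eq (hm : IsMesh a b N x) (hwa : w a = 0) {i : ℕ} (hi : i < N) {y : ℝ}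
    (hy : y ∈ Icc (x i) (x (i + 1))) :
    nodalInterp N x w y
      = w (x i) + (w (x (i + 1)) - w (x i)) / (x (i + 1) - x i) * (y - x i) := by
  have h1 : nodalInterp N x w y = ∑ j ∈ Finset.range (i + 1),
      (w (x (j + 1)) - w (x j)) / (x (j + 1) - x j)
        * max 0 (min (y - x j) (x (j + 1) - x j)) := by
    refine (Finset.sum_subset (Finset.range_mono hi) fun j hj hj' => ?_).symm
    rw [Finset.mem_range] at hj hj'
    have : y ≤ x j := hy.2.trans (hm.mono (by omega) hj.le)
    rw [max_eq_left ((min_le_left _ _).trans (by linarith)), mul_zero]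
  have h2 : ∀ j ∈ Finset.range i, (w (x (j + 1)) - w (x j)) / (x (j + 1) - x j)
      * max 0 (min (y - x j) (x (j + 1) - x j)) = w (x (j + 1)) - w (x j) := by
    intro j hj
    rw [Finset.mem_range] at hj
    have hlt := hm.lt j (by omega)
    have hle : x (j + 1) ≤ y := (hm.mono (by omega) hi.le).trans hy.1
    rw [min_eq_right (by linarith), max_eq_right (by linarith),
      div_mul_cancel₀ _ (sub_pos.2 hlt).ne']
  rw [h1, Finset.sum_range_succ, Finset.sum_congr rfl h2, Finset.sum_range_sub (fun j => w (x j)),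
    hm.left, hwa, sub_zero, min_eq_left (by linarith [hy.2]), max_eq_right (by linarith [hy.1])]

theorem memVh_nodalInterp (hm : IsMesh a b N x) (hw : MemH10 a b w) :
    MemVh a b N x (nodalInterp N x w) := by
  refine ⟨continuous_nodalInterp.continuousOn, fun y hy => ?_, fun j hj => ?_⟩
  · rcases le_or_gt y a with h1 | h1
    · refine Finset.sum_eq_zero fun j hj => ?_
      rw [Finset.mem_range] at hj
      have := hm.left_le hj.le
      rw [max_eq_left ((min_le_left _ _).trans (by linarith)), mul_zero]
    · have h2 : b ≤ y := not_lt.1 fun h2 => hy ⟨h1, h2⟩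
      have h3 : ∀ j ∈ Finset.range N, (w (x (j + 1)) - w (x j)) / (x (j + 1) - x j)
          * max 0 (min (y - x j) (x (j + 1) - x j)) = w (x (j + 1)) - w (x j) := by
        intro j hj
        rw [Finset.mem_range] at hj
        have hlt := hm.lt j hj
        have hle : x (j + 1) ≤ b := hm.le_right hj
        rw [min_eq_right (by linarith), max_eq_right (by linarith),
          div_mul_cancel₀ _ (sub_pos.2 hlt).ne']
      rw [nodalInterp, Finset.sum_congr rfl h3, Finset.sum_range_sub (fun j => w (x j)),
        hm.left, hm.right, hw.left, hw.right, sub_zero]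
  · refine ⟨w (x j) - (w (x (j + 1)) - w (x j)) / (x (j + 1) - x j) * x j,
      (w (x (j + 1)) - w (x j)) / (x (j + 1) - x j), fun y hy => ?_⟩
    rw [nodalInterp_eq hm hw.left hj hy]
    ring

/-- Insert Poincaré for `v` into `‖v'‖² ≤ ‖v''‖ ‖v‖` and divide. Applied to one cell this is the
interpolation estimate. -/
theorem l2norm_deriv_le_c2_mul (hab : a < b) (h1 : IsPrim a b v q) (h2 : IsPrim a b q r)
    (ha : v a = 0) (hb : v b = 0) : l2norm a b q ≤ c2 a b * l2norm a b r := by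
  have h3 := l2norm_deriv_sq_le hab.le h1 h2 ha hb
  have h4 := mul_le_mul_of_nonneg_left (l2norm_le_c2_mul hab h1 ha hb) (l2norm_nonneg a b r)
  rcases (l2norm_nonneg a b q).eq_or_lt with h0 | h0
  · rw [← h0]
    exact mul_nonneg (c2_pos hab).le (l2norm_nonneg _ _ _)
  · refine le_of_mul_le_mul_right ?_ h0
    rw [← pow_two]
    linarith

/-- The interpolation error estimate. -/
theorem l2norm_weakDeriv_sub_nodalInterp_le (hab : a < b) (hm : IsMesh a b N x) {h : ℝ}
    (hh : ∀ j < N, x (j + 1) - x j = h) (hw : MemH10 a b w) (h1 : IsPrim a b w q)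
    (h2 : IsPrim a b q r) :
    l2norm a b (weakDeriv a b fun y => w y - nodalInterp N x w y)
      ≤ h / Real.pi * l2norm a b r := by
  have hI := memVh_nodalInterp hm hw
  have hz := hw.sub hab (hI.memH10 hab hm)
  have pz := hz.isPrim hab
  have hh0 : 0 < h := by
    rw [← hh 0 (hm.pos hab)]
    exact sub_pos.2 (hm.lt 0 (hm.pos hab))
  have hsplit : ∀ g, MemL2 a b g → ∫ y in a..b, g y ^ 2
      = ∑ j ∈ Finset.range N, ∫ y in x j..x (j + 1), g y ^ 2 := fun g hg => by
    rw [intervalIntegral.sum_integral_adjacent_intervals fun j hj =>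
      (hg.mono (hm.left_le hj.le) (hm.le_right hj)).sq (hm.lt j hj).le, hm.left, hm.right]
  refine (pow_le_pow_iff_left₀ (l2norm_nonneg _ _ _)
    (mul_nonneg (div_pos hh0 Real.pi_pos).le (l2norm_nonneg _ _ _)) two_ne_zero).1 ?_
  rw [mul_pow, l2norm_sq hab.le, l2norm_sq hab.le, hsplit _ pz.memL2, hsplit _ h2.memL2,
    Finset.mul_sum]
  refine Finset.sum_le_sum fun j hj => ?_
  rw [Finset.mem_range] at hj
  have hlt := hm.lt j hj
  have hl := hm.left_le hj.le
  have hr := hm.le_right (j := j + 1) hj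
  obtain ⟨α, β, hαβ⟩ := hI.affine j hj
  -- On one cell the interpolation error vanishes at both ends, and its second derivative is that of
  -- `w`, because the interpolant is affine.
  have pc := (h1.mono hl hlt.le hr).sub (isPrim_affine hαβ hlt.le)
  have pc2 : IsPrim (x j) (x (j + 1)) (fun y => q y - β) r := by
    simpa using (h2.mono hl hlt.le hr).sub (isPrim_const β)
  have e := ((pz.mono hl hlt.le hr).isWeakDeriv hlt.le).ae_eq hlt.le (pc.isWeakDeriv hlt.le)
  have key := l2norm_deriv_le_c2_mul hlt pc pc2
    (by rw [nodalInterp_eq hm hw.left hj (left_mem_Icc.2 hlt.le)]; ring)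
    (by
      rw [nodalInterp_eq hm hw.left hj (right_mem_Icc.2 hlt.le),
        div_mul_cancel₀ _ (sub_pos.2 hlt).ne']
      ring)
  rw [← l2norm_congr hlt.le e, c2, hh j hj] at key
  rw [← l2norm_sq hlt.le, ← l2norm_sq hlt.le, ← mul_pow]
  exact pow_le_pow_left₀ (l2norm_nonneg _ _ _) key 2
variable {h c₃ : ℝ}

/-! ### Error estimates for the finite element method -/

theorem MemH10.exists_isPrim_of_memH2 (hab : a < b) (h1 : MemH10 a b v) (h2 : MemH2 a b v) :
    ∃ q, IsPrim a b v q ∧ IsPrim a b q (weakDeriv a b (weakDeriv a b v)) := by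
  have pv := h1.isPrim hab
  obtain ⟨g, hg⟩ := h2.2.2
  obtain ⟨q, hq, e⟩ := (isWeakDeriv_weakDeriv hg).exists_isPrim hab
    (pv.memL2.intervalIntegrable hab.le)
  exact ⟨q, pv.congr_right e, hq⟩

theorem IsMesh.step_pos (hab : a < b) (hm : IsMesh a b N x) (hh : ∀ j < N, x (j + 1) - x j = h) :
    0 < h := by
  rw [← hh 0 (hm.pos hab)]
  exact sub_pos.2 (hm.lt 0 (hm.pos hab))

theorem exists_memVh_close (hab : a < b) (hm : IsMesh a b N x)
    (hh : ∀ j < N, x (j + 1) - x j = h) (h1 : MemH10 a b w) (h2 : MemH2 a b w) :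
    ∃ z, MemVh a b N x z ∧ l2norm a b (weakDeriv a b fun y => w y - z y)
      ≤ h / Real.pi * l2norm a b (weakDeriv a b (weakDeriv a b w)) := by
  obtain ⟨q, p1, p2⟩ := h1.exists_isPrim_of_memH2 hab h2
  exact ⟨nodalInterp N x w, memVh_nodalInterp hm h1,
    l2norm_weakDeriv_sub_nodalInterp_le hab hm hh h1 p1 p2⟩

/-- Regularity constants are not assumed positive. Positivity follows from the mesh condition, since
`h0` would otherwise be nonpositive (zero for `c₃ = 0`, by the convention on division). -/
theorem pos_of_pos_le_h0 (hab : a < b) (hσ : 0 < σ) (hμ : 0 < μ) (hlam : 0 < lam) (h0 : 0 < h)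
    (hle : h ≤ JumpOU.h0 a b σ μ lam c₃) : 0 < c₃ := by
  by_contra hc
  rw [not_lt] at hc
  have hc1 := c1_pos hab hσ hμ hlam
  have : JumpOU.h0 a b σ μ lam c₃ ≤ 0 := by
    rw [JumpOU.h0]
    exact div_nonpos_of_nonneg_of_nonpos hσ.le
      (mul_nonpos_of_nonneg_of_nonpos (by positivity) hc)
  linarith

theorem sq_le_of_le_h0 (hab : a < b) (hσ : 0 < σ) (hμ : 0 < μ) (hlam : 0 < lam) (h0 : 0 < h)
    (hle : h ≤ JumpOU.h0 a b σ μ lam c₃) : (c1 a b σ μ lam * c₃ * h) ^ 2 ≤ σ ^ 2 / (2 * μ) := by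
  have hc1 := c1_pos hab hσ hμ hlam
  have hc := pos_of_pos_le_h0 hab hσ hμ hlam h0 hle
  have hs : 0 < Real.sqrt 2 * Real.sqrt μ := by positivity
  rw [JumpOU.h0, le_div_iff₀ (by positivity)] at hle
  have h2 : c1 a b σ μ lam * c₃ * h ≤ σ / (Real.sqrt 2 * Real.sqrt μ) := by
    rw [le_div_iff₀ hs]; linarith
  refine (pow_le_pow_left₀ (by positivity) h2 2).trans (le_of_eq ?_)
  rw [div_pow, mul_pow, Real.sq_sqrt (by norm_num), Real.sq_sqrt hμ.le]

/-- The energy norm estimate of the finite element error. -/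
theorem l2norm_weakDeriv_error_le (hab : a < b) (hσ : 0 < σ) (hμ : 0 < μ) (hlam : 0 < lam)
    (hφ : IsJumpDensity φ) (hc : IsRegularityConst a b σ μ lam φ c₃) (hm : IsMesh a b N x)
    (hh : ∀ j < N, x (j + 1) - x j = h) (hle : h ≤ h0 a b σ μ lam c₃) (hf : MemL2 a b f)
    (hv : IsWeakSolution a b σ μ lam φ f v) (hu : IsFEMSolution a b σ μ lam φ f N x u) :
    l2norm a b (weakDeriv a b fun y => v y - u y)
      ≤ 4 / σ ^ 2 * (c1 a b σ μ lam * c₃ * (h / Real.pi)) * l2norm a b f := by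
  have h0 := hm.step_pos hab hh
  have hc1 := c1_pos hab hσ hμ hlam
  have hc3 := pos_of_pos_le_h0 hab hσ hμ hlam h0 hle
  have hsq := sq_le_of_le_h0 hab hσ hμ hlam h0 hle
  have hu10 := hu.1.memH10 hab hm
  have he := hv.1.sub hab hu10
  have horth : ∀ ψ, MemVh a b N x ψ → bilin a b σ μ lam φ (fun y => v y - u y) ψ = 0 := by
    intro ψ hψ
    rw [bilin_sub_left hab hφ hv.1 hu10 (hψ.memH10 hab hm), hv.2 ψ (hψ.memH10 hab hm),
      hu.2 ψ hψ, sub_self]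
  have hpi := Real.pi_pos
  have nE := l2norm_nonneg a b (weakDeriv a b fun y => v y - u y)
  have ne := l2norm_nonneg a b fun y => v y - u y
  have nF := l2norm_nonneg a b f
  -- Aubin–Nitsche: solve the adjoint problem with the error as right-hand side and subtract the
  -- interpolant of its solution by Galerkin orthogonality.
  have hdual : l2norm a b (fun y => v y - u y)
      ≤ c1 a b σ μ lam * c₃ * (h / Real.pi)
        * l2norm a b (weakDeriv a b fun y => v y - u y) := by
    obtain ⟨w, hw, -⟩ := existsUnique_isAdjointWeakSolution hab hσ hμ hlam hφ he.memH1.1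
    obtain ⟨hw2, hwb⟩ := hc.2 _ w he.memH1.1 hw
    obtain ⟨z, hz, hzb⟩ := exists_memVh_close hab hm hh hw.1 hw2
    have hz10 := hz.memH10 hab hm
    have e1 : l2norm a b (fun y => v y - u y) ^ 2
        = bilin a b σ μ lam φ (fun y => v y - u y) fun y => w y - z y := by
      rw [bilin_sub_right hab hφ he hz10 hw.1, horth z hz, sub_zero, hw.2 _ he,
        l2norm_sq hab.le, l2inner]
      simp only [pow_two]
    have e2 := (le_abs_self _).trans
      (abs_bilin_le (σ := σ) hab hφ hμ.le hlam.le he (hw.1.sub hab hz10))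
    rw [← e1] at e2
    have e3 := hzb.trans (mul_le_mul_of_nonneg_left hwb (by positivity))
    have e4 := e2.trans (mul_le_mul_of_nonneg_left e3 (by positivity))
    rcases ne.eq_or_lt with h' | h'
    · rw [← h']; positivity
    · refine le_of_mul_le_mul_right ?_ h'
      rw [← pow_two]
      linarith
  obtain ⟨hv2, hvb⟩ := hc.1 f v hf hv
  obtain ⟨z, hz, hzb⟩ := exists_memVh_close hab hm hh hv.1 hv2
  have hz10 := hz.memH10 hab hm
  -- Céa's step: orthogonality replaces the discrete solution in the second argument by the
  -- interpolant of `v`.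
  have e1 : bilin a b σ μ lam φ (fun y => v y - u y) (fun y => v y - u y)
      = bilin a b σ μ lam φ (fun y => v y - u y) fun y => v y - z y := by
    rw [bilin_sub_right hab hφ he hz10 hv.1, bilin_sub_right hab hφ he hu10 hv.1, horth z hz,
      horth u hu.1]
  have e2 := (le_abs_self _).trans
    (abs_bilin_le (σ := σ) hab hφ hμ.le hlam.le he (hv.1.sub hab hz10))
  have e3 := hzb.trans (mul_le_mul_of_nonneg_left hvb (by positivity))
  have e4 := e2.trans (mul_le_mul_of_nonneg_left e3 (by positivity))
  have hg := garding (σ := σ) (μ := μ) hab hφ hlam.le he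
  rw [e1] at hg
  set E := l2norm a b (weakDeriv a b fun y => v y - u y)
  set e := l2norm a b fun y => v y - u y
  set F := l2norm a b f
  set C := c1 a b σ μ lam
  -- This is where `h0` enters: the negative Gårding term takes at most half of the positive one.
  -- The factor `1/π` is discarded.
  have h5 : μ / 2 * e ^ 2 ≤ σ ^ 2 / 4 * E ^ 2 := by
    have t1 : e ^ 2 ≤ (C * c₃ * (h / Real.pi) * E) ^ 2 := pow_le_pow_left₀ ne hdual 2
    have t2 : C * c₃ * (h / Real.pi) ≤ C * c₃ * h :=
      mul_le_mul_of_nonneg_left (div_le_self h0.le (by linarith [Real.pi_gt_three]))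
        (by positivity)
    have t3 : (C * c₃ * (h / Real.pi)) ^ 2 ≤ σ ^ 2 / (2 * μ) :=
      (pow_le_pow_left₀ (by positivity) t2 2).trans hsq
    calc μ / 2 * e ^ 2 ≤ μ / 2 * (σ ^ 2 / (2 * μ) * E ^ 2) := by
          refine mul_le_mul_of_nonneg_left (t1.trans ?_) (by positivity)
          rw [mul_pow]
          exact mul_le_mul_of_nonneg_right t3 (sq_nonneg _)
      _ = σ ^ 2 / 4 * E ^ 2 := by field_simp; ring
  have h6 : σ ^ 2 / 4 * E ^ 2 ≤ C * E * (h / Real.pi * (c₃ * F)) := by linarith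
  rcases nE.eq_or_lt with h' | h'
  · rw [← h']; positivity
  · refine le_of_mul_le_mul_right ?_ h'
    have t : 4 / σ ^ 2 * (C * c₃ * (h / Real.pi)) * F * E
        = 4 / σ ^ 2 * (C * E * (h / Real.pi * (c₃ * F))) := by ring
    have t' : E * E = 4 / σ ^ 2 * (σ ^ 2 / 4 * E ^ 2) := by field_simp
    rw [t, t']
    exact mul_le_mul_of_nonneg_left h6 (by positivity)

theorem existsUnique_isFEMSolution (hab : a < b) (hσ : 0 < σ) (hμ : 0 < μ) (hlam : 0 < lam)
    (hφ : IsJumpDensity φ) (hc : IsRegularityConst a b σ μ lam φ c₃) (hm : IsMesh a b N x)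
    (hh : ∀ j < N, x (j + 1) - x j = h) (hle : h ≤ h0 a b σ μ lam c₃) (hf : MemL2 a b f) :
    ∃! u, IsFEMSolution a b σ μ lam φ f N x u := by
  -- For zero data the exact solution is zero, so the error estimate, which presupposes no discrete
  -- solvability, already forces `u = 0`.
  have huniq : ∀ u, IsFEMSolution a b σ μ lam φ (fun _ => 0) N x u → u = 0 := by
    intro u hu
    have he := l2norm_weakDeriv_error_le hab hσ hμ hlam hφ hc hm hh hle memL2_zero
      (isWeakSolution_zero hab) hu
    have hz : l2norm a b (fun _ => 0) = 0 := by simp [l2norm]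
    rw [hz, mul_zero] at he
    ext y
    have h1 := ((memH10_zero hab.le).sub hab (hu.1.memH10 hab hm)).abs_le hab y
    rw [le_antisymm he (l2norm_nonneg _ _ _), mul_zero] at h1
    simpa using h1
  obtain ⟨u, hu⟩ := exists_isFEMSolution hab hφ hm hf huniq
  refine ⟨u, hu, fun u' hu' => ?_⟩
  have hd : u' - u = 0 := by
    have hmem : MemVh a b N x (u' - u) := (feSpace a b N x).sub_mem hu'.1 hu.1
    refine huniq _ ⟨hmem, fun ψ hψ => ?_⟩
    have := bilin_sub_left (σ := σ) (μ := μ) (lam := lam) hab hφ (hu'.1.memH10 hab hm)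
      (hu.1.memH10 hab hm) (hψ.memH10 hab hm)
    rw [hu.2 ψ hψ, hu'.2 ψ hψ, sub_self] at this
    exact this.trans (by simp [l2inner])
  exact sub_eq_zero.1 hd

/-! ### The derivative at the end point -/

theorem IsPrim.hasDerivWithinAt_right (hab : a < b) (h1 : IsPrim a b v q)
    (hq : ContinuousOn q (Icc a b)) : HasDerivWithinAt v (q b) (Icc a b) b := by
  have hd : ∀ y ∈ Ioo a b, HasDerivAt v (q y) y := fun y hy => h1.hasDerivAt hab.le hq hy
  have hb := right_mem_Icc.2 hab.le
  have hn : Ioo a b ∈ nhdsWithin b (Iio b) := Ioo_mem_nhdsLT hab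
  refine (hasDerivWithinAt_Iic_of_tendsto_deriv (s := Ioo a b)
    (fun y hy => (hd y hy).differentiableAt.differentiableWithinAt)
    ((h1.continuousOn hab.le b hb).mono Ioo_subset_Icc_self) hn ?_).mono Icc_subset_Iic_self
  have hlim : Filter.Tendsto q (nhdsWithin b (Iio b)) (nhds (q b)) := by
    rw [← nhdsWithin_Ioo_eq_nhdsLT hab]
    exact (hq b hb).mono Ioo_subset_Icc_self
  refine hlim.congr' ?_
  filter_upwards [hn] with y hy
  exact (hd y hy).deriv.symm

theorem hasDerivWithinAt_of_affine {α β : ℝ} (hcb : c < b)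
    (h : ∀ y ∈ Icc c b, v y = α + β * y) : HasDerivWithinAt v β (Icc a b) b := by
  have h1 : HasDerivAt (fun y => α + β * y) β b := by
    simpa using ((hasDerivAt_id b).const_mul β).const_add α
  have h2 : HasDerivWithinAt v β (Icc c b) b :=
    h1.hasDerivWithinAt.congr h (h b (right_mem_Icc.2 hcb.le))
  refine h2.mono_of_mem_nhdsWithin ?_
  filter_upwards [self_mem_nhdsWithin, mem_nhdsWithin_of_mem_nhds (Ioi_mem_nhds hcb)] with y h3 h4
  exact ⟨le_of_lt h4, h3.2⟩

theorem abs_deriv_sub_le_of_affine {α β : ℝ} (hcb : c < b) (h1 : IsPrim c b v q)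
    (h2 : IsPrim c b q r) (h3 : ∀ y ∈ Icc c b, u y = α + β * y)
    (h4 : IsPrim c b (fun y => v y - u y) g) :
    (b - c) * |q b - β| ≤ (b - c) * (Real.sqrt (b - c) * l2norm c b r)
      + Real.sqrt (b - c) * l2norm c b g := by
  have hL : 0 < b - c := sub_pos.2 hcb
  have hl := left_mem_Icc.2 hcb.le
  have hr := right_mem_Icc.2 hcb.le
  have hqi := (h2.memL2_left hcb.le).intervalIntegrable hcb.le
  have h5 := (h1.sub (isPrim_affine h3 hcb.le)).sub_eq hl hr
  rw [h4.sub_eq hl hr] at h5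
  -- The constant slope `β` is averaged over the cell: `q b - β` is the mean of `q b - q` plus the
  -- mean of the derivative of the error.
  have e : (b - c) * (q b - β) = (∫ t in c..b, (q b - q t)) + ∫ t in c..b, g t := by
    rw [h5, intervalIntegral.integral_sub intervalIntegrable_const hqi,
      intervalIntegral.integral_sub hqi intervalIntegrable_const, intervalIntegral.integral_const,
      intervalIntegral.integral_const, smul_eq_mul, smul_eq_mul]
    ring
  have e1 : |∫ t in c..b, (q b - q t)| ≤ Real.sqrt (b - c) * l2norm c b r * |b - c| := by
    rw [← Real.norm_eq_abs]
    refine intervalIntegral.norm_integral_le_of_norm_le_const fun t ht => ?_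
    rw [uIoc_of_le hcb.le] at ht
    rw [Real.norm_eq_abs, h2.sub_eq ⟨ht.1.le, ht.2⟩ hr]
    exact (abs_integral_le ht.2 (h2.memL2.mono ht.1.le le_rfl)).trans
      (mul_le_mul (Real.sqrt_le_sqrt (by linarith [ht.1]))
        (l2norm_mono hcb.le ht.1.le ht.2 le_rfl h2.memL2) (l2norm_nonneg _ _ _)
        (Real.sqrt_nonneg _))
  rw [abs_of_pos hL] at e1
  have e2 := abs_integral_le hcb.le h4.memL2
  rw [← abs_of_pos hL, ← abs_mul, abs_of_pos hL, e]
  refine (abs_add_le _ _).trans ?_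
  linarith

/-- The error estimate for the derivative at the right end point. -/
theorem endDerivClose_of_isFEMSolution (hab : a < b) (hσ : 0 < σ) (hμ : 0 < μ) (hlam : 0 < lam)
    (hφ : IsJumpDensity φ) (hc : IsRegularityConst a b σ μ lam φ c₃) (hm : IsMesh a b N x)
    (hh : ∀ j < N, x (j + 1) - x j = h) (hle : h ≤ h0 a b σ μ lam c₃) (hf : MemL2 a b f)
    (hv : IsWeakSolution a b σ μ lam φ f v) (hu : IsFEMSolution a b σ μ lam φ f N x u) :
    EndDerivClose a b v u (c10 a b σ μ lam c₃ * Real.sqrt h * l2norm a b f) := by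
  have h0 := hm.step_pos hab hh
  have hc1 := c1_pos hab hσ hμ hlam
  have hc3 := pos_of_pos_le_h0 hab hσ hμ hlam h0 hle
  have hN := hm.pos hab
  obtain ⟨n, rfl⟩ : ∃ n, N = n + 1 := ⟨N - 1, by omega⟩
  obtain ⟨hv2, hvb⟩ := hc.1 f v hf hv
  obtain ⟨q, p1, p2⟩ := hv.1.exists_isPrim_of_memH2 hab hv2
  obtain ⟨α, β, hαβ⟩ := hu.1.affine n n.lt_succ_self
  have hlt := hm.lt n n.lt_succ_self
  have hstep := hh n n.lt_succ_self
  have hl := hm.left_le (j := n) n.le_succ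
  rw [hm.right] at hαβ hlt hstep
  have he := hv.1.sub hab (hu.1.memH10 hab hm)
  have pe := he.isPrim hab
  refine ⟨q b, β, p1.hasDerivWithinAt_right hab (p2.continuousOn hab.le),
    hasDerivWithinAt_of_affine hlt hαβ, ?_⟩
  have key := abs_deriv_sub_le_of_affine hlt (p1.mono hl hlt.le le_rfl) (p2.mono hl hlt.le le_rfl)
    hαβ (pe.mono hl hlt.le le_rfl)
  rw [hstep] at key
  have hE := (l2norm_mono hab.le hl hlt.le le_rfl pe.memL2).trans
    (l2norm_weakDeriv_error_le hab hσ hμ hlam hφ hc hm hh hle hf hv hu)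
  have hR := (l2norm_mono hab.le hl hlt.le le_rfl p2.memL2).trans hvb
  have nF := l2norm_nonneg a b f
  have hpi := Real.pi_gt_three
  have hs := Real.sqrt_nonneg h
  have key2 : h * |q b - β| ≤ h * (Real.sqrt h * (c₃ * l2norm a b f))
      + Real.sqrt h * (4 / σ ^ 2 * (c1 a b σ μ lam * c₃ * (h / Real.pi)) * l2norm a b f) :=
    key.trans (add_le_add
      (mul_le_mul_of_nonneg_left (mul_le_mul_of_nonneg_left hR hs) h0.le)
      (mul_le_mul_of_nonneg_left hE hs))
  have key3 : |q b - β|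
      ≤ (c₃ + 4 / σ ^ 2 * (c1 a b σ μ lam * c₃) / Real.pi) * (Real.sqrt h * l2norm a b f) := by
    refine le_of_mul_le_mul_left (key2.trans (le_of_eq ?_)) h0
    field_simp
  refine key3.trans ?_
  rw [mul_assoc]
  refine mul_le_mul_of_nonneg_right ?_ (by positivity)
  have hc2 := c2_pos hab
  have hM : 0 ≤ max |a| |b| := (abs_nonneg a).trans (le_max_left _ _)
  -- Since `σ²/2 ≤ c1` and `π > 2`, each of the two contributions is at most half of `4 c1 c₃ / σ²`;
  -- the summand `2` of `c10` is slack.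
  have t1 : c₃ ≤ 4 / σ ^ 2 * (c1 a b σ μ lam * c₃) / 2 := by
    have : σ ^ 2 / 2 ≤ c1 a b σ μ lam := by
      rw [c1]
      have : 0 ≤ c2 a b * (μ * max |a| |b| + 2 * lam * c2 a b) := by positivity
      linarith
    calc c₃ = 4 / σ ^ 2 * (σ ^ 2 / 2 * c₃) / 2 := by field_simp; ring
      _ ≤ _ := by gcongr
  have t2 : 4 / σ ^ 2 * (c1 a b σ μ lam * c₃) / Real.pi
      ≤ 4 / σ ^ 2 * (c1 a b σ μ lam * c₃) / 2 :=
    div_le_div_of_nonneg_left (by positivity) two_pos (by linarith)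
  have t3 : c10 a b σ μ lam c₃ = 2 + 4 / σ ^ 2 * (c1 a b σ μ lam * c₃) := by rw [c10]; ring
  rw [t3]
  linarith

theorem l2norm_neg_mul_id (hμ : 0 ≤ μ) :
    l2norm a b (fun y => -μ * y) = μ * Real.sqrt ((b ^ 3 - a ^ 3) / 3) := by
  rw [l2norm_const_mul, abs_neg, abs_of_nonneg hμ, l2norm, integral_pow]
  norm_num

end JumpOU

end

theorem mainTheorem4 (a b σ μ lam : ℝ) (φ : ℝ → ℝ)
    (ha : a < 0) (hab : a < b) (hσ : 0 < σ) (hμ : 0 < μ) (hlam : 0 < lam)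
    (hφ : JumpOU.IsJumpDensity φ) :
    -- the boundary value problem and its adjoint are uniquely solvable in the weak sense
    (∀ f : ℝ → ℝ, JumpOU.MemL2 a b f →
      (∃! v : ℝ → ℝ, JumpOU.IsWeakSolution a b σ μ lam φ f v) ∧
      (∃! w : ℝ → ℝ, JumpOU.IsAdjointWeakSolution a b σ μ lam φ f w)) ∧
    -- the explicit `c₃`, which does not depend on `φ`, is a regularity constant
    JumpOU.IsRegularityConst a b σ μ lam φ (JumpOU.c3 a b σ μ lam) ∧
    -- for every regularity constant `c₃` and every uniform mesh with `h ≤ h₀`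
    ∀ c₃ : ℝ, JumpOU.IsRegularityConst a b σ μ lam φ c₃ →
      ∀ (N : ℕ) (x : ℕ → ℝ) (h : ℝ), JumpOU.IsMesh a b N x →
        (∀ j < N, x (j + 1) - x j = h) → h ≤ JumpOU.h0 a b σ μ lam c₃ →
        (∀ f v : ℝ → ℝ, JumpOU.MemL2 a b f → JumpOU.IsWeakSolution a b σ μ lam φ f v →
          (∃! vh : ℝ → ℝ, JumpOU.IsFEMSolution a b σ μ lam φ f N x vh) ∧
          ∀ vh : ℝ → ℝ, JumpOU.IsFEMSolution a b σ μ lam φ f N x vh →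
            JumpOU.EndDerivClose a b v vh
              (JumpOU.c10 a b σ μ lam c₃ * Real.sqrt h * JumpOU.l2norm a b f)) ∧
        (∀ v vh : ℝ → ℝ, JumpOU.IsWeakSolution a b σ μ lam φ (fun y => -μ * y) v →
          JumpOU.IsFEMSolution a b σ μ lam φ (fun y => -μ * y) N x vh →
            JumpOU.EndDerivClose a b v vh
              (JumpOU.c11 a b σ μ lam c₃ * Real.sqrt h)) := by
  refine ⟨fun f hf => ⟨?_, JumpOU.existsUnique_isAdjointWeakSolution hab hσ hμ hlam hφ hf⟩,
    JumpOU.isRegularityConst_c3 hab hσ hμ hlam hφ, fun c₃ hc N x h hm hh hle =>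
      ⟨fun f v hf hv => ⟨JumpOU.existsUnique_isFEMSolution hab hσ hμ hlam hφ hc hm hh hle hf,
        fun vh hvh => JumpOU.endDerivClose_of_isFEMSolution hab hσ hμ hlam hφ hc hm hh hle hf hv
          hvh⟩, fun v vh hv hvh => ?_⟩⟩
  · obtain ⟨v, hv⟩ := JumpOU.exists_isWeakSolution hab hσ hμ hlam hφ hf
    exact ⟨v, hv, fun w hw => hw.unique hab hσ hμ hlam hφ hf hv⟩
  · have hf : JumpOU.MemL2 a b fun y => -μ * y :=
      JumpOU.memL2_of_continuousOn (by fun_prop)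
    have := JumpOU.endDerivClose_of_isFEMSolution hab hσ hμ hlam hφ hc hm hh hle hf hv hvh
    rw [JumpOU.l2norm_neg_mul_id hμ.le] at this
    convert this using 1
    rw [JumpOU.c11]
    ring
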